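/- Theorem (Distance to a random subspace). A real random variable $\xi$ is called subgaussian with subgaussian moment at most $B>0$ if $\mathbb{P}(|\xi|>t)\le 2e^{-t^2/B^2}$ for all $t>0$. For all $B,B'>0$ there exist constants $C,c>0$ and $\tilde c\in(0,1)$, depending only on $B$ and $B'$, such that the following holds. Let $N,m$ be integers with $0<m<\tilde cN$. Let $X$ be a random vector in $\mathbb{R}^N$ whose coordinates are independent and identically distributed mean zero, unit variance subgaussian random variables with subgaussian moment at most $B$. Let $Y_1,\dots,Y_{N-m}$ be random vectors in $\mathbb{R}^N$ such that all $(N-m)N$ of their coordinates are independent and identically distributed mean zero, unit variance subgaussian random variables with subgaussian moment at most $B'$ (their common distribution may differ from that of the coordinates of $X$), and such that $(Y_1,\dots,Y_{N-m})$ is independent of $X$. Let $H=\mathrm{span}(Y_1,\dots,Y_{N-m})$. Then for every (deterministic) $v\in\mathbb{R}^N$ and every $\varepsilon>0$, $$\mathbb{P}\big(\mathrm{dist}(X,H+v)<\varepsilon\sqrt m\big)\le (C\varepsilon)^m+e^{-cN},$$ where $\mathrm{dist}$ is the Euclidean distance from a point to a set. -/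

import Mathlib

open MeasureTheory ProbabilityTheory

/-- `ξ` is a subgaussian random variable whose subgaussian moment is at most `B`:
`P(|ξ| > t) ≤ 2 exp(-t² / B²)` for all `t > 0`. -/
def SubgaussianWith {Ω : Type*} [MeasurableSpace Ω] (B : ℝ) (ξ : Ω → ℝ) (μ : Measure Ω) : Prop :=
  0 < B ∧ ∀ t : ℝ, 0 < t → μ.real {ω | t < |ξ ω|} ≤ 2 * Real.exp (-t ^ 2 / B ^ 2)

/-- The family `ξ` consists of (jointly) independent and identically distributed mean zero
random variables with unit variance, subgaussian with subgaussian moment at most `B`. -/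
structure IsIIDSubgaussian {Ω ι : Type*} [MeasurableSpace Ω] (B : ℝ) (ξ : ι → Ω → ℝ)
    (μ : Measure Ω) : Prop where
  measurable : ∀ i, Measurable (ξ i)
  indep : iIndepFun ξ μ
  identDistrib : ∀ i j, IdentDistrib (ξ i) (ξ j) μ μ
  mean_zero : ∀ i, ∫ ω, ξ i ω ∂μ = 0
  unit_variance : ∀ i, variance (ξ i) μ = 1
  subgaussian : ∀ i, SubgaussianWith B (ξ i) μ

/-- The linear span of the vectors `Y j`, `j ∈ J`, in `ℝ^N`. -/
def spanOf {N : ℕ} {J : Type*} (Y : J → EuclideanSpace ℝ (Fin N)) :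
    Submodule ℝ (EuclideanSpace ℝ (Fin N)) :=
  Submodule.span ℝ (Set.range Y)

/-- The translate `H + v` of a linear subspace `H` of `ℝ^N`. -/
def subspaceTranslate {N : ℕ} (H : Submodule ℝ (EuclideanSpace ℝ (Fin N)))
    (v : EuclideanSpace ℝ (Fin N)) : Set (EuclideanSpace ℝ (Fin N)) :=
  {x | ∃ h ∈ H, x = h + v}

/-! Let `L` be the random matrix with rows `Y_j`. Its kernel is the orthogonal complement of `H` and
has dimension at least `m`. If `A` embeds `ℝ^m` isometrically into `ker L`, then `A*` is a
contraction that vanishes on `H`, so `dist(X, H + v) ≥ ‖A*X - A*v‖`. By independence `Y` can be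
frozen, and a small ball estimate for `A*X` in `ℝ^m` is enough.

Small ball estimate (`IsIIDSubgaussian.small_ball`): the mean of `exp(-‖A*X - u‖²/(2ε²))` is a
Gaussian average of characters, and independence of the coordinates bounds it by an average of
products of one-dimensional characteristic functions. After symmetrization such a product is
governed by sums of `1 - cos`, hence by the distance from multiples of `A g` to the integer lattice.
If every `x` in `ker L` with `‖x‖ < D` stays at distance at least `min(γ‖x‖, α)` from the lattice,
the resulting bound is `e^{m/2}((Cε)^m + e^{-qα²})` for every `ε ≥ √m / D`.

Arithmetic of the kernel (`exists_measure_kernel_nearLattice_le`): this holds with `α` of order `√N`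
and `D` of order `√N e^{cN/m}`, outside an event of probability `e^{-cN}`. The union bound runs over
lattice points. About `(Cy)^N` of them have norm of order `y√N`. A fixed vector of that norm, whose
shorter multiples avoid the lattice, is mapped by `L` to length of order `aN` with probability at
most `(Ca/y)^{N-m}`, by the case `m = 1` of the same small ball estimate. The powers of `y` cancel
up to `y^m`, which is at most `e^{cN}` while `y ≤ e^{cN/m}`, and a small `a` beats the constants.
The condition on shorter multiples costs nothing: one looks at the lowest dyadic level where the
kernel comes near the lattice. Below norm `c₁√N` there are so few lattice points that a crude lower
bound for `‖Lp‖` is enough. -/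

/-! ### Moments and symmetrization of a subgaussian variable. -/

theorem SubgaussianWith.integral_exp_sq {Ω : Type*} [MeasurableSpace Ω] {μ : Measure Ω}
    [IsProbabilityMeasure μ] {B : ℝ} {ξ : Ω → ℝ} (hξ : Measurable ξ)
    (h : SubgaussianWith B ξ μ) :
    Integrable (fun ω => Real.exp (ξ ω ^ 2 / (2 * B ^ 2))) μ ∧
      ∫ ω, Real.exp (ξ ω ^ 2 / (2 * B ^ 2)) ∂μ ≤ 3 := by
  obtain ⟨hB, htail⟩ := h
  set f : Ω → ℝ := fun ω => Real.exp (ξ ω ^ 2 / (2 * B ^ 2)) with hf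
  have hfm : Measurable f := by fun_prop
  have hf0 : 0 ≤ᵐ[μ] f := Filter.Eventually.of_forall fun ω => (Real.exp_pos _).le
  -- At the level `B √(2 log t)` the tail hypothesis reads `2 t⁻²`. The layer-cake integral then
  -- gives at most 1 on `(0, 1]` and 2 beyond, hence the constant 3.
  have hmeas : ∀ t : ℝ, 1 < t → μ {ω | t < f ω} ≤ ENNReal.ofReal (2 * t ^ (-2 : ℝ)) := by
    intro t ht
    have hlog : 0 < Real.log t := Real.log_pos ht
    have hs : 0 < B * √(2 * Real.log t) := by positivity
    have hsub : {ω | t < f ω} ⊆ {ω | B * √(2 * Real.log t) < |ξ ω|} := by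
      intro ω hω
      have h1 : Real.log t < ξ ω ^ 2 / (2 * B ^ 2) :=
        (Real.log_lt_iff_lt_exp (by linarith)).2 hω
      rw [lt_div_iff₀ (by positivity)] at h1
      refine lt_of_pow_lt_pow_left₀ 2 (abs_nonneg (ξ ω)) ?_
      rw [mul_pow, Real.sq_sqrt (by positivity), sq_abs]
      linarith
    calc μ {ω | t < f ω} ≤ μ {ω | B * √(2 * Real.log t) < |ξ ω|} := measure_mono hsub
      _ = ENNReal.ofReal (μ.real {ω | B * √(2 * Real.log t) < |ξ ω|}) := by
          rw [ofReal_measureReal]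
      _ ≤ _ := by
          refine ENNReal.ofReal_le_ofReal ((htail _ hs).trans_eq ?_)
          rw [Real.rpow_def_of_pos (by linarith), mul_pow, Real.sq_sqrt (by positivity)]
          congr 2
          field_simp
  have hlin : ∫⁻ ω, ENNReal.ofReal (f ω) ∂μ ≤ ENNReal.ofReal 3 := by
    rw [lintegral_eq_lintegral_meas_lt μ hf0 hfm.aemeasurable,
      ← Set.Ioc_union_Ioi_eq_Ioi (zero_le_one' ℝ),
      lintegral_union measurableSet_Ioi (Set.disjoint_left.2 fun x h1 h2 => not_lt.2 h1.2 h2)]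
    have h1 : ∫⁻ t in Set.Ioc (0 : ℝ) 1, μ {ω | t < f ω} ≤ 1 := by
      calc _ ≤ ∫⁻ _ in Set.Ioc (0 : ℝ) 1, 1 := lintegral_mono fun t => prob_le_one
        _ = 1 := by simp
    have h2 : ∫⁻ t in Set.Ioi (1 : ℝ), μ {ω | t < f ω} ≤ ENNReal.ofReal 2 := by
      calc _ ≤ ∫⁻ t in Set.Ioi (1 : ℝ), ENNReal.ofReal (2 * t ^ (-2 : ℝ)) :=
            setLIntegral_mono' measurableSet_Ioi fun t ht => hmeas t ht
        _ = ENNReal.ofReal 2 := by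
          rw [← ofReal_integral_eq_lintegral_ofReal]
          · rw [integral_const_mul, integral_Ioi_rpow_of_lt (by norm_num) (by norm_num)]
            norm_num
          · exact (integrableOn_Ioi_rpow_of_lt (by norm_num) (by norm_num)).const_mul 2
          · refine (ae_restrict_iff' measurableSet_Ioi).2 (Filter.Eventually.of_forall fun t ht => ?_)
            have : (0 : ℝ) < t := lt_trans one_pos ht
            simp only [Pi.zero_apply]
            positivity
    calc _ ≤ 1 + ENNReal.ofReal 2 := add_le_add h1 h2
      _ = ENNReal.ofReal 3 := by
        rw [← ENNReal.ofReal_one, ← ENNReal.ofReal_add (by norm_num) (by norm_num)]; norm_num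
  have hint : Integrable f μ := by
    refine ⟨hfm.aestronglyMeasurable, ?_⟩
    rw [hasFiniteIntegral_iff_ofReal hf0]
    exact hlin.trans_lt ENNReal.ofReal_lt_top
  refine ⟨hint, ?_⟩
  rw [integral_eq_lintegral_of_nonneg_ae hf0 hfm.aestronglyMeasurable]
  exact ENNReal.toReal_le_of_le_ofReal (by norm_num) hlin

theorem SubgaussianWith.integrable_pow_four {Ω : Type*} [MeasurableSpace Ω] {μ : Measure Ω}
    [IsProbabilityMeasure μ] {B : ℝ} {ξ : Ω → ℝ} (hξ : Measurable ξ)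
    (h : SubgaussianWith B ξ μ) :
    Integrable (fun ω => ξ ω ^ 4) μ ∧ ∫ ω, ξ ω ^ 4 ∂μ ≤ 24 * B ^ 4 := by
  obtain ⟨h1, h2⟩ := h.integral_exp_sq hξ
  have hB := h.1
  have hle : ∀ ω, ξ ω ^ 4 ≤ 8 * B ^ 4 * Real.exp (ξ ω ^ 2 / (2 * B ^ 2)) := by
    intro ω
    have hx : 0 ≤ ξ ω ^ 2 / (2 * B ^ 2) := by positivity
    have := Real.quadratic_le_exp_of_nonneg hx
    have h3 : ξ ω ^ 4 = 8 * B ^ 4 * ((ξ ω ^ 2 / (2 * B ^ 2)) ^ 2 / 2) := by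
      field_simp; ring
    rw [h3]
    gcongr
    linarith
  have hint : Integrable (fun ω => ξ ω ^ 4) μ :=
    (h1.const_mul (8 * B ^ 4)).mono' (by fun_prop) (Filter.Eventually.of_forall fun ω => by
      rw [Real.norm_of_nonneg (by positivity)]; exact hle ω)
  refine ⟨hint, ?_⟩
  calc ∫ ω, ξ ω ^ 4 ∂μ ≤ ∫ ω, 8 * B ^ 4 * Real.exp (ξ ω ^ 2 / (2 * B ^ 2)) ∂μ :=
        integral_mono hint (h1.const_mul _) hle
    _ = 8 * B ^ 4 * ∫ ω, Real.exp (ξ ω ^ 2 / (2 * B ^ 2)) ∂μ := integral_const_mul _ _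
    _ ≤ 8 * B ^ 4 * 3 := by gcongr
    _ = _ := by ring

/-- The linear term disappears when a centred variable is averaged, leaving only a square in the
exponent. -/
theorem exp_le_add_exp_sq (x : ℝ) : Real.exp x ≤ x + Real.exp (x ^ 2) := by
  rcases le_or_gt |x| 1 with h | h
  · have h1 := (abs_le.1 (Real.abs_exp_sub_one_sub_id_le h)).2
    have h2 := Real.add_one_le_exp (x ^ 2)
    linarith
  · rcases lt_abs.1 h with h | h
    · have : Real.exp x ≤ Real.exp (x ^ 2) := Real.exp_le_exp.2 (by nlinarith)
      linarith
    · have h1 : Real.exp x ≤ 1 := Real.exp_le_one_iff.2 (by linarith)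
      have h2 := Real.add_one_le_exp (x ^ 2)
      nlinarith

/-- Every subgaussian random variable of mean zero has a subgaussian moment generating function. -/
theorem SubgaussianWith.hasSubgaussianMGF {Ω : Type*} [MeasurableSpace Ω] {μ : Measure Ω}
    [IsProbabilityMeasure μ] {B : ℝ} {ξ : Ω → ℝ} (hξ : Measurable ξ)
    (h : SubgaussianWith B ξ μ) (h0 : ∫ ω, ξ ω ∂μ = 0) :
    HasSubgaussianMGF ξ (Real.toNNReal (11 * B ^ 2)) μ := by
  obtain ⟨h1, h2⟩ := h.integral_exp_sq hξ
  have hB := h.1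
  set M := ∫ ω, Real.exp (ξ ω ^ 2 / (2 * B ^ 2)) ∂μ with hM
  have hξ1 : Integrable ξ μ := by
    refine ((h1.const_mul (2 * B ^ 2)).add (integrable_const 1)).mono' hξ.aestronglyMeasurable
      (Filter.Eventually.of_forall fun ω => ?_)
    have h3 := Real.add_one_le_exp (ξ ω ^ 2 / (2 * B ^ 2))
    have h4 : ξ ω ^ 2 = 2 * B ^ 2 * (ξ ω ^ 2 / (2 * B ^ 2)) := by field_simp
    have h5 : ξ ω ^ 2 ≤ 2 * B ^ 2 * Real.exp (ξ ω ^ 2 / (2 * B ^ 2)) := by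
      rw [h4]
      gcongr
      · rw [← h4]; linarith
    rw [Real.norm_eq_abs]
    simp only [Pi.add_apply]
    nlinarith [sq_abs (ξ ω), sq_nonneg (|ξ ω| - 1)]
  have hbd : ∀ s : ℝ, ∀ ω, Real.exp (s * ξ ω) ≤
      Real.exp (s ^ 2 * B ^ 2 / 2) * Real.exp (ξ ω ^ 2 / (2 * B ^ 2)) := by
    intro s ω
    rw [← Real.exp_add]
    apply Real.exp_le_exp.2
    have : s ^ 2 * B ^ 2 / 2 + ξ ω ^ 2 / (2 * B ^ 2) - s * ξ ω =
      (s * B - ξ ω / B) ^ 2 / 2 := by field_simp; ring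
    nlinarith [sq_nonneg (s * B - ξ ω / B)]
  have hexp : ∀ s : ℝ, Integrable (fun ω => Real.exp (s * ξ ω)) μ := fun s =>
    (h1.const_mul (Real.exp (s ^ 2 * B ^ 2 / 2))).mono' (by fun_prop)
      (Filter.Eventually.of_forall fun ω => by
        rw [Real.norm_of_nonneg (Real.exp_pos _).le]; exact hbd s ω)
  refine ⟨hexp, fun s => ?_⟩
  rw [Real.coe_toNNReal _ (by positivity)]
  have he2 : (3 : ℝ) ≤ Real.exp 2 := by
    have := Real.add_one_le_exp (2 : ℝ); linarith
  -- For small `s`, mean zero and convexity of `exp` between 0 and `ξ²/(2B²)` give `1 + 4B²s²`. For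
  -- large `s`, Young's inequality `hbd` suffices, and the factor `3 ≤ e²` is absorbed because `s²B²
  -- > 1/2`. The constant 11 leaves room in both cases.
  rcases le_or_gt (s ^ 2 * (2 * B ^ 2)) 1 with hs | hs
  · rcases eq_or_ne s 0 with rfl | hs0
    · simp [mgf]
    have hsq : 0 < s ^ 2 * (2 * B ^ 2) := by positivity
    have hconv : ∀ ω, Real.exp ((s * ξ ω) ^ 2) ≤
        1 + s ^ 2 * (2 * B ^ 2) * (Real.exp (ξ ω ^ 2 / (2 * B ^ 2)) - 1) := by
      intro ω
      set a := s ^ 2 * (2 * B ^ 2)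
      have hc := convexOn_exp.2 (Set.mem_univ (ξ ω ^ 2 / (2 * B ^ 2))) (Set.mem_univ 0)
        hsq.le (sub_nonneg.2 hs) (by ring)
      simp only [smul_eq_mul, mul_zero, add_zero, Real.exp_zero, mul_one] at hc
      have : (s * ξ ω) ^ 2 = a * (ξ ω ^ 2 / (2 * B ^ 2)) := by simp only [a]; field_simp
      rw [this]
      linarith
    have hi : Integrable (fun ω => s * ξ ω +
        (1 + s ^ 2 * (2 * B ^ 2) * (Real.exp (ξ ω ^ 2 / (2 * B ^ 2)) - 1))) μ :=
      (hξ1.const_mul s).add ((integrable_const _).add ((h1.sub (integrable_const _)).const_mul _))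
    calc mgf ξ μ s ≤ ∫ ω, (s * ξ ω +
        (1 + s ^ 2 * (2 * B ^ 2) * (Real.exp (ξ ω ^ 2 / (2 * B ^ 2)) - 1))) ∂μ := by
          refine integral_mono (hexp s) hi fun ω => ?_
          have := exp_le_add_exp_sq (s * ξ ω)
          have := hconv ω
          dsimp only
          linarith
      _ = 1 + s ^ 2 * (2 * B ^ 2) * (M - 1) := by
          have e1 : Integrable (fun ω => s ^ 2 * (2 * B ^ 2) *
            (Real.exp (ξ ω ^ 2 / (2 * B ^ 2)) - 1)) μ := (h1.sub (integrable_const _)).const_mul _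
          have e2 : Integrable (fun ω => 1 + s ^ 2 * (2 * B ^ 2) *
            (Real.exp (ξ ω ^ 2 / (2 * B ^ 2)) - 1)) μ := (integrable_const _).add e1
          rw [integral_add (hξ1.const_mul s) e2, integral_add (integrable_const _) e1, integral_const_mul, integral_const_mul,
            integral_sub h1 (integrable_const _), h0]
          simp [hM]
      _ ≤ 1 + s ^ 2 * (2 * B ^ 2) * 2 := by gcongr; linarith
      _ ≤ 11 * B ^ 2 * s ^ 2 / 2 + 1 := by nlinarith
      _ ≤ _ := Real.add_one_le_exp _
  · calc mgf ξ μ s ≤ ∫ ω, Real.exp (s ^ 2 * B ^ 2 / 2) *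
          Real.exp (ξ ω ^ 2 / (2 * B ^ 2)) ∂μ :=
          integral_mono (hexp s) (h1.const_mul _) (hbd s)
      _ = Real.exp (s ^ 2 * B ^ 2 / 2) * M := integral_const_mul _ _
      _ ≤ Real.exp (s ^ 2 * B ^ 2 / 2) * Real.exp 2 := by gcongr; linarith
      _ ≤ _ := by
        rw [← Real.exp_add]
        apply Real.exp_le_exp.2
        nlinarith

theorem HasSubgaussianMGF.subgaussianWith {Ω : Type*} [MeasurableSpace Ω] {μ : Measure Ω}
    [IsProbabilityMeasure μ] {b : ℝ} {ξ : Ω → ℝ} (hb : 0 < b)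
    (h : HasSubgaussianMGF ξ (Real.toNNReal (b ^ 2)) μ) :
    SubgaussianWith (2 * b) ξ μ := by
  refine ⟨by positivity, fun t ht => ?_⟩
  have h1 := h.measure_ge_le ht.le
  have h2 := h.neg.measure_ge_le ht.le
  rw [Real.coe_toNNReal _ (by positivity)] at h1 h2
  have hsub : {ω | t < |ξ ω|} ⊆ {ω | t ≤ ξ ω} ∪ {ω | t ≤ (-ξ) ω} := by
    intro ω hω
    rcases lt_abs.1 (show t < |ξ ω| from hω) with h | h
    · exact Or.inl h.le
    · exact Or.inr h.le
  have h3 : Real.exp (-t ^ 2 / (2 * b ^ 2)) ≤ Real.exp (-t ^ 2 / (2 * b) ^ 2) := by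
    apply Real.exp_le_exp.2
    rw [neg_div, neg_div, neg_le_neg_iff]
    apply div_le_div_of_nonneg_left (by positivity) (by positivity)
    nlinarith [sq_nonneg b]
  calc μ.real {ω | t < |ξ ω|} ≤ μ.real ({ω | t ≤ ξ ω} ∪ {ω | t ≤ (-ξ) ω}) :=
        measureReal_mono hsub
    _ ≤ _ := measureReal_union_le _ _
    _ ≤ 2 * Real.exp (-t ^ 2 / (2 * b) ^ 2) := by linarith

/-- Bounded fourth moment and unit variance prevent concentration of `ξ - ξ'` near zero. -/
theorem SubgaussianWith.symm_mass {Ω : Type*} [MeasurableSpace Ω] {μ : Measure Ω}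
    [IsProbabilityMeasure μ] {B : ℝ} {ξ : Ω → ℝ} (hξ : Measurable ξ)
    (h : SubgaussianWith B ξ μ) (h0 : ∫ ω, ξ ω ∂μ = 0) (hv : variance ξ μ = 1) :
    1 / (600 * B ^ 4) ≤ (μ.prod μ).real {p | 1 ≤ |ξ p.1 - ξ p.2|} := by
  obtain ⟨h4, h4'⟩ := h.integrable_pow_four hξ
  have hB := h.1
  have h2 : Integrable (fun ω => ξ ω ^ 2) μ := by
    refine (h4.add (integrable_const 1)).mono' (by fun_prop)
      (Filter.Eventually.of_forall fun ω => ?_)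
    rw [Real.norm_of_nonneg (by positivity)]
    simp only [Pi.add_apply]
    nlinarith [sq_nonneg (ξ ω ^ 2 - 1)]
  have h1 : Integrable ξ μ := by
    refine (h2.add (integrable_const 1)).mono' (by fun_prop)
      (Filter.Eventually.of_forall fun ω => ?_)
    rw [Real.norm_eq_abs]
    simp only [Pi.add_apply]
    nlinarith [sq_abs (ξ ω), sq_nonneg (|ξ ω| - 1)]
  have hsq : ∫ ω, ξ ω ^ 2 ∂μ = 1 := by
    rw [variance_eq_integral hξ.aemeasurable, h0] at hv
    simpa using hv
  set Z : Ω × Ω → ℝ := fun p => ξ p.1 - ξ p.2 with hZ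
  have hZm : Measurable Z := by fun_prop
  set A : Set (Ω × Ω) := {p | 1 ≤ |Z p|} with hA
  have hAm : MeasurableSet A := measurableSet_le measurable_const (by fun_prop)
  have i1 : Integrable (fun p : Ω × Ω => ξ p.1 ^ 2) (μ.prod μ) := h2.comp_fst μ
  have i2 : Integrable (fun p : Ω × Ω => ξ p.2 ^ 2) (μ.prod μ) := h2.comp_snd μ
  have i3 : Integrable (fun p : Ω × Ω => ξ p.1 * ξ p.2) (μ.prod μ) := h1.mul_prod h1
  have hZ2 : ∫ p, Z p ^ 2 ∂(μ.prod μ) = 2 := by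
    have : ∀ p, Z p ^ 2 = ξ p.1 ^ 2 + ξ p.2 ^ 2 - 2 * (ξ p.1 * ξ p.2) := fun p => by
      simp only [hZ]; ring
    simp_rw [this]
    have i12 : Integrable (fun p : Ω × Ω => ξ p.1 ^ 2 + ξ p.2 ^ 2) (μ.prod μ) := i1.add i2
    rw [integral_sub i12 (i3.const_mul 2), integral_add i1 i2, integral_const_mul,
      integral_prod_mul ξ ξ, h0, integral_fun_fst (fun ω => ξ ω ^ 2),
      integral_fun_snd (fun ω => ξ ω ^ 2), hsq]
    norm_num
  have j1 : Integrable (fun p : Ω × Ω => ξ p.1 ^ 4) (μ.prod μ) := h4.comp_fst μ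
  have j2 : Integrable (fun p : Ω × Ω => ξ p.2 ^ 4) (μ.prod μ) := h4.comp_snd μ
  have hZ4i : Integrable (fun p => 8 * (ξ p.1 ^ 4 + ξ p.2 ^ 4)) (μ.prod μ) :=
    (j1.add j2).const_mul 8
  have hZ4 : ∫ p, 8 * (ξ p.1 ^ 4 + ξ p.2 ^ 4) ∂(μ.prod μ) ≤ 384 * B ^ 4 := by
    rw [integral_const_mul, integral_add j1 j2, integral_fun_fst (fun ω => ξ ω ^ 4),
      integral_fun_snd (fun ω => ξ ω ^ 4)]
    simp only [probReal_univ, one_smul]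
    linarith
  -- `z² ≤ 1 + a 1_{|z| ≥ 1} + z⁴ / (4 a)`
  have key : ∀ p, Z p ^ 2 ≤ 1 + A.indicator (fun _ => 384 * B ^ 4) p +
      (8 * (ξ p.1 ^ 4 + ξ p.2 ^ 4)) / (4 * (384 * B ^ 4)) := by
    intro p
    have hz4 : Z p ^ 4 ≤ 8 * (ξ p.1 ^ 4 + ξ p.2 ^ 4) := by
      have e1 : Z p ^ 2 ≤ 2 * (ξ p.1 ^ 2 + ξ p.2 ^ 2) := by
        simp only [hZ]; nlinarith [sq_nonneg (ξ p.1 + ξ p.2)]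
      calc Z p ^ 4 = (Z p ^ 2) ^ 2 := by ring
        _ ≤ (2 * (ξ p.1 ^ 2 + ξ p.2 ^ 2)) ^ 2 := by gcongr
        _ ≤ _ := by nlinarith [sq_nonneg (ξ p.1 ^ 2 - ξ p.2 ^ 2)]
    by_cases hp : p ∈ A
    · rw [Set.indicator_of_mem hp]
      have e2 : Z p ^ 4 / (4 * (384 * B ^ 4)) ≤
        (8 * (ξ p.1 ^ 4 + ξ p.2 ^ 4)) / (4 * (384 * B ^ 4)) := by gcongr
      have e3 : 384 * B ^ 4 + Z p ^ 4 / (4 * (384 * B ^ 4)) - Z p ^ 2 =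
        (384 * B ^ 4 - Z p ^ 2 / 2) ^ 2 / (384 * B ^ 4) := by field_simp; ring
      have e4 : 0 ≤ (384 * B ^ 4 - Z p ^ 2 / 2) ^ 2 / (384 * B ^ 4) := by positivity
      linarith
    · rw [Set.indicator_of_notMem hp]
      have e1 : |Z p| < 1 := not_le.1 hp
      have e2 : Z p ^ 2 < 1 := by rw [← sq_abs]; nlinarith [abs_nonneg (Z p)]
      have : 0 ≤ (8 * (ξ p.1 ^ 4 + ξ p.2 ^ 4)) / (4 * (384 * B ^ 4)) := by positivity
      linarith
  have iZ2 : Integrable (fun p => Z p ^ 2) (μ.prod μ) := by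
    have : (fun p => Z p ^ 2) = fun p => ξ p.1 ^ 2 + ξ p.2 ^ 2 - 2 * (ξ p.1 * ξ p.2) := by
      ext p; simp only [hZ]; ring
    rw [this]
    exact (i1.add i2).sub (i3.const_mul 2)
  have iA : Integrable (A.indicator (fun _ => 384 * B ^ 4)) (μ.prod μ) :=
    (integrable_const _).indicator hAm
  have hfin := integral_mono iZ2 (((integrable_const (1 : ℝ)).add iA).add
    (hZ4i.div_const (4 * (384 * B ^ 4)))) key
  have hfin' : ∫ p, (1 + A.indicator (fun _ => 384 * B ^ 4) p +
      (8 * (ξ p.1 ^ 4 + ξ p.2 ^ 4)) / (4 * (384 * B ^ 4))) ∂(μ.prod μ) =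
      1 + (μ.prod μ).real A * (384 * B ^ 4) +
        (∫ p, 8 * (ξ p.1 ^ 4 + ξ p.2 ^ 4) ∂(μ.prod μ)) / (4 * (384 * B ^ 4)) := by
    have iB : Integrable (fun p => 1 + A.indicator (fun _ => 384 * B ^ 4) p) (μ.prod μ) :=
      (integrable_const _).add iA
    rw [integral_add iB (hZ4i.div_const _),
      integral_add (integrable_const _) iA, integral_div, integral_indicator_const _ hAm]
    simp
  have hfin2 := hfin.trans_eq hfin'
  rw [hZ2] at hfin2
  have e5 : (∫ p, 8 * (ξ p.1 ^ 4 + ξ p.2 ^ 4) ∂(μ.prod μ)) / (4 * (384 * B ^ 4)) ≤ 1 / 4 := by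
    rw [div_le_iff₀ (by positivity)]; linarith
  -- Here `384 B⁴` bounds the fourth moment of `Z`, so the quartic term contributes at most 1/4, and
  -- `E Z² = 2` leaves 3/4 for the event.
  have e6 : 3 / 4 ≤ (μ.prod μ).real A * (384 * B ^ 4) := by linarith
  rw [div_le_iff₀ (by positivity)]
  linarith

/-! ### The standard Gaussian measure and averages over balls. -/

section GaussianWeight

variable (m : ℕ)

/-- The density of the standard Gaussian measure on `ℝ^m`. -/
noncomputable def gaussWeight (g : EuclideanSpace ℝ (Fin m)) : ℝ :=
  (2 * Real.pi) ^ (-(m : ℝ) / 2) * Real.exp (-‖g‖ ^ 2 / 2)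

/-- The standard Gaussian measure on `ℝ^m`, given by its density. -/
noncomputable def gaussVec : Measure (EuclideanSpace ℝ (Fin m)) :=
  volume.withDensity fun g => ENNReal.ofReal (gaussWeight m g)

variable {m}

theorem gaussWeight_pos (g : EuclideanSpace ℝ (Fin m)) : 0 < gaussWeight m g := by
  unfold gaussWeight; positivity

theorem continuous_gaussWeight : Continuous (gaussWeight m) := by
  unfold gaussWeight; fun_prop

theorem integral_gaussVec {F : Type*} [NormedAddCommGroup F] [NormedSpace ℝ F]
    (f : EuclideanSpace ℝ (Fin m) → F) :
    ∫ g, f g ∂(gaussVec m) = ∫ g, gaussWeight m g • f g := by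
  rw [gaussVec, integral_withDensity_eq_integral_toReal_smul
    (continuous_gaussWeight.measurable.ennreal_ofReal)
    (Filter.Eventually.of_forall fun _ => ENNReal.ofReal_lt_top)]
  simp_rw [ENNReal.toReal_ofReal (gaussWeight_pos _).le]

theorem charFun_gaussVec (t : EuclideanSpace ℝ (Fin m)) :
    charFun (gaussVec m) t = Real.exp (-‖t‖ ^ 2 / 2) := by
  rw [charFun_apply, integral_gaussVec]
  have h := GaussianFourier.integral_cexp_neg_mul_sq_norm_add (V := EuclideanSpace ℝ (Fin m))
    (b := 1 / 2) (by norm_num) Complex.I t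
  have h1 : ∀ g : EuclideanSpace ℝ (Fin m),
      gaussWeight m g • Complex.exp ((inner ℝ g t : ℝ) * Complex.I) =
      (((2 * Real.pi) ^ (-(m : ℝ) / 2) : ℝ) : ℂ) *
        Complex.exp (-(1 / 2) * (‖g‖ : ℂ) ^ 2 + Complex.I * (inner ℝ t g : ℝ)) := by
    intro g
    rw [Complex.exp_add, gaussWeight, real_inner_comm, Complex.real_smul]
    push_cast
    ring_nf
  simp_rw [h1]
  rw [integral_const_mul, h, finrank_euclideanSpace, Fintype.card_fin]
  have h2 : ((Real.pi : ℂ) / (1 / 2)) ^ ((m : ℂ) / 2) =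
      (((2 * Real.pi) ^ ((m : ℝ) / 2) : ℝ) : ℂ) := by
    rw [Complex.ofReal_cpow (by positivity)]
    push_cast
    congr 1
    ring
  rw [h2, ← mul_assoc, ← Complex.ofReal_mul, ← Real.rpow_add (by positivity)]
  rw [Complex.I_sq]
  have : -(m : ℝ) / 2 + m / 2 = 0 := by ring
  rw [this, Real.rpow_zero]
  push_cast
  ring_nf

instance : IsProbabilityMeasure (gaussVec m) := by
  have hi : Integrable (fun g : EuclideanSpace ℝ (Fin m) => gaussWeight m g) := by
    have := GaussianFourier.integrable_cexp_neg_mul_sq_norm_add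
      (V := EuclideanSpace ℝ (Fin m)) (b := 1 / 2) (by norm_num) 0 0
    refine ((this.norm.const_mul ((2 * Real.pi) ^ (-(m : ℝ) / 2))).congr
      (Filter.Eventually.of_forall fun g => ?_))
    simp only [gaussWeight, Complex.norm_exp]
    congr 2
    simp [← Complex.ofReal_pow]
    ring
  have h1 := charFun_gaussVec (m := m) 0
  rw [charFun_apply, integral_gaussVec] at h1
  simp only [inner_zero_right, Complex.ofReal_zero, zero_mul, Complex.exp_zero, norm_zero,
    Complex.real_smul, mul_one] at h1
  have h2 : ∫ g : EuclideanSpace ℝ (Fin m), gaussWeight m g = 1 := by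
    rw [integral_complex_ofReal] at h1
    simpa using h1
  refine ⟨?_⟩
  rw [gaussVec, withDensity_apply _ MeasurableSet.univ, Measure.restrict_univ,
    ← ofReal_integral_eq_lintegral_ofReal hi
      (Filter.Eventually.of_forall fun g => (gaussWeight_pos g).le), h2]
  simp

/-- Averages of the Gaussian density over balls dominate its central value. -/
theorem gaussWeight_le_lintegral_ball (y : EuclideanSpace ℝ (Fin m)) {R : ℝ} :
    ENNReal.ofReal (gaussWeight m y) * (ENNReal.ofReal (Real.exp (-R ^ 2 / 2)) *
        volume (Metric.ball (0 : EuclideanSpace ℝ (Fin m)) R)) ≤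
      ∫⁻ w in Metric.ball y R, ENNReal.ofReal (gaussWeight m w) := by
  set W : EuclideanSpace ℝ (Fin m) → ENNReal := fun w => ENNReal.ofReal (gaussWeight m w) with hW
  have hWm : Measurable W := continuous_gaussWeight.measurable.ennreal_ofReal
  set D : Set (EuclideanSpace ℝ (Fin m)) := Metric.ball 0 R
  have hD : MeasurableSet D := measurableSet_ball
  have e1 : ∫⁻ w in Metric.ball y R, W w = ∫⁻ u, D.indicator (fun u => W (y + u)) u := by
    rw [← lintegral_indicator measurableSet_ball,
      ← lintegral_add_left_eq_self (μ := (volume : Measure (EuclideanSpace ℝ (Fin m)))) _ y]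
    refine lintegral_congr fun u => ?_
    by_cases hu : u ∈ D
    · rw [Set.indicator_of_mem hu, Set.indicator_of_mem]
      simpa [D] using hu
    · rw [Set.indicator_of_notMem hu, Set.indicator_of_notMem]
      simpa [D] using hu
  have e2 : ∫⁻ u, D.indicator (fun u => W (y + u)) u = ∫⁻ u, D.indicator (fun u => W (y - u)) u := by
    rw [← lintegral_neg_eq_self]
    refine lintegral_congr fun u => ?_
    by_cases hu : u ∈ D
    · rw [Set.indicator_of_mem hu, Set.indicator_of_mem (by simpa [D] using hu), sub_eq_add_neg]
    · rw [Set.indicator_of_notMem hu, Set.indicator_of_notMem (by simpa [D] using hu)]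
  -- The inequality is doubled so as to pair `y + u` with `y - u`: the cross terms combine to `2
  -- cosh⟨y, u⟩ ≥ 2`, and only the factor `exp(-‖u‖²/2)` is lost.
  have e3 : ENNReal.ofReal (gaussWeight m y) * (ENNReal.ofReal (Real.exp (-R ^ 2 / 2)) *
      volume D) + ENNReal.ofReal (gaussWeight m y) *
        (ENNReal.ofReal (Real.exp (-R ^ 2 / 2)) * volume D) ≤
      (∫⁻ w in Metric.ball y R, W w) + ∫⁻ w in Metric.ball y R, W w := by
    rw [e1]
    nth_rewrite 2 [e2]
    have hm1 : Measurable (fun u => D.indicator (fun u => W (y + u)) u) :=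
      (hWm.comp (measurable_const_add y)).indicator hD
    rw [← lintegral_add_left hm1]
    have : ENNReal.ofReal (gaussWeight m y) * (ENNReal.ofReal (Real.exp (-R ^ 2 / 2)) *
      volume D) + ENNReal.ofReal (gaussWeight m y) *
        (ENNReal.ofReal (Real.exp (-R ^ 2 / 2)) * volume D) =
        ∫⁻ u, D.indicator (fun _ => ENNReal.ofReal
          (2 * gaussWeight m y * Real.exp (-R ^ 2 / 2))) u := by
      rw [lintegral_indicator_const hD, ← two_mul, ← mul_assoc, ← mul_assoc,
        ENNReal.ofReal_mul (by have := gaussWeight_pos y; positivity),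
        ENNReal.ofReal_mul (by norm_num)]
      simp
    rw [this]
    refine lintegral_mono fun u => ?_
    by_cases hu : u ∈ D
    · simp only [Set.indicator_of_mem hu, hW]
      rw [← ENNReal.ofReal_add (gaussWeight_pos _).le (gaussWeight_pos _).le]
      apply ENNReal.ofReal_le_ofReal
      have hu' : ‖u‖ < R := by simpa [D] using hu
      have hu2 : ‖u‖ ^ 2 ≤ R ^ 2 := by gcongr
      have n1 := norm_add_sq_real y u
      have n2 := norm_sub_sq_real y u
      simp only [gaussWeight]
      rw [n1, n2]
      have s1 : Real.exp (-(‖y‖ ^ 2 + 2 * inner ℝ y u + ‖u‖ ^ 2) / 2) =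
          Real.exp (-‖y‖ ^ 2 / 2) * Real.exp (-‖u‖ ^ 2 / 2) * Real.exp (-inner ℝ y u) := by
        rw [← Real.exp_add, ← Real.exp_add]; congr 1; ring
      have s2 : Real.exp (-(‖y‖ ^ 2 - 2 * inner ℝ y u + ‖u‖ ^ 2) / 2) =
          Real.exp (-‖y‖ ^ 2 / 2) * Real.exp (-‖u‖ ^ 2 / 2) * Real.exp (inner ℝ y u) := by
        rw [← Real.exp_add, ← Real.exp_add]; congr 1; ring
      rw [s1, s2]
      have s3 : Real.exp (-R ^ 2 / 2) ≤ Real.exp (-‖u‖ ^ 2 / 2) := Real.exp_le_exp.2 (by linarith)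
      have s4 : 2 ≤ Real.exp (-inner ℝ y u) + Real.exp (inner ℝ y u) := by
        have := Real.add_one_le_exp (inner ℝ y u)
        have := Real.add_one_le_exp (-inner ℝ y u)
        linarith
      set c := (2 * Real.pi) ^ (-(m : ℝ) / 2)
      have hc : 0 ≤ c := by positivity
      calc 2 * (c * Real.exp (-‖y‖ ^ 2 / 2)) * Real.exp (-R ^ 2 / 2) ≤
          2 * (c * Real.exp (-‖y‖ ^ 2 / 2)) * Real.exp (-‖u‖ ^ 2 / 2) := by gcongr
        _ = c * (Real.exp (-‖y‖ ^ 2 / 2) * Real.exp (-‖u‖ ^ 2 / 2)) * 2 := by ring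
        _ ≤ c * (Real.exp (-‖y‖ ^ 2 / 2) * Real.exp (-‖u‖ ^ 2 / 2)) *
            (Real.exp (-inner ℝ y u) + Real.exp (inner ℝ y u)) := by gcongr
        _ = _ := by ring
    · simp [Set.indicator_of_notMem hu]
  rw [← two_mul, ← two_mul] at e3
  exact (ENNReal.mul_le_mul_iff_right (by norm_num) (by norm_num)).1 e3

/-- A function whose integrals over all balls of radius `R` are at most `M` has a Gaussian
integral of at most `exp (R² / 2) M / |B_R|`. -/
theorem lintegral_gaussVec_le {F : EuclideanSpace ℝ (Fin m) → ENNReal} (hF : Measurable F)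
    {R : ℝ} {M : ENNReal} (hM : ∀ w, ∫⁻ y in Metric.ball w R, F y ≤ M) :
    (∫⁻ y, F y ∂(gaussVec m)) * (ENNReal.ofReal (Real.exp (-R ^ 2 / 2)) *
        volume (Metric.ball (0 : EuclideanSpace ℝ (Fin m)) R)) ≤ M := by
  set W : EuclideanSpace ℝ (Fin m) → ENNReal := fun w => ENNReal.ofReal (gaussWeight m w) with hW
  have hWm : Measurable W := continuous_gaussWeight.measurable.ennreal_ofReal
  have hmeas : Measurable (fun p : EuclideanSpace ℝ (Fin m) × EuclideanSpace ℝ (Fin m) =>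
      {q : EuclideanSpace ℝ (Fin m) × EuclideanSpace ℝ (Fin m) |
        dist q.1 q.2 < R}.indicator (fun q => F q.1 * W q.2) p) := by
    refine Measurable.indicator ?_ (measurableSet_lt (by fun_prop) (by fun_prop))
    exact (hF.comp measurable_fst).mul (hWm.comp measurable_snd)
  calc (∫⁻ y, F y ∂(gaussVec m)) * (ENNReal.ofReal (Real.exp (-R ^ 2 / 2)) *
        volume (Metric.ball (0 : EuclideanSpace ℝ (Fin m)) R))
      = ∫⁻ y, F y * (W y * (ENNReal.ofReal (Real.exp (-R ^ 2 / 2)) *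
        volume (Metric.ball (0 : EuclideanSpace ℝ (Fin m)) R))) := by
        rw [gaussVec, lintegral_withDensity_eq_lintegral_mul _ hWm hF, ← lintegral_mul_const _
          (hWm.mul hF)]
        refine lintegral_congr fun y => ?_
        simp only [Pi.mul_apply]
        ring
    -- The weight is replaced by its ball average; Tonelli then moves the ball onto `F`, where the
    -- hypothesis applies.
    _ ≤ ∫⁻ y, F y * ∫⁻ w in Metric.ball y R, W w := by
        gcongr with y
        exact gaussWeight_le_lintegral_ball y
    _ = ∫⁻ y, ∫⁻ w, {q : EuclideanSpace ℝ (Fin m) × EuclideanSpace ℝ (Fin m) |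
        dist q.1 q.2 < R}.indicator (fun q => F q.1 * W q.2) (y, w) := by
        refine lintegral_congr fun y => ?_
        rw [← lintegral_const_mul _ hWm, ← lintegral_indicator measurableSet_ball]
        refine lintegral_congr fun w => ?_
        by_cases h : dist y w < R
        · rw [Set.indicator_of_mem (Metric.mem_ball'.2 h), Set.indicator_of_mem (by exact h)]
        · rw [Set.indicator_of_notMem (fun h' => h (Metric.mem_ball'.1 h')),
            Set.indicator_of_notMem (by exact h)]
    _ = ∫⁻ w, ∫⁻ y, {q : EuclideanSpace ℝ (Fin m) × EuclideanSpace ℝ (Fin m) |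
        dist q.1 q.2 < R}.indicator (fun q => F q.1 * W q.2) (y, w) :=
        lintegral_lintegral_swap hmeas.aemeasurable
    _ = ∫⁻ w, (∫⁻ y in Metric.ball w R, F y) * W w := by
        refine lintegral_congr fun w => ?_
        rw [← lintegral_mul_const _ hF, ← lintegral_indicator measurableSet_ball]
        refine lintegral_congr fun y => ?_
        by_cases h : dist y w < R
        · rw [Set.indicator_of_mem (Metric.mem_ball.2 h), Set.indicator_of_mem (by exact h)]
        · rw [Set.indicator_of_notMem (fun h' => h (Metric.mem_ball.1 h')),
            Set.indicator_of_notMem (by exact h)]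
    _ ≤ ∫⁻ w, M * W w := by
        gcongr with w
        exact hM w
    _ = M := by
        rw [lintegral_const_mul _ hWm]
        have : ∫⁻ w, W w = gaussVec m Set.univ := by
          rw [gaussVec, withDensity_apply _ MeasurableSet.univ, Measure.restrict_univ]
        rw [this, measure_univ, mul_one]

theorem Gamma_half_add_one_le (m : ℕ) : Real.Gamma ((m : ℝ) / 2 + 1) ≤ √(m : ℝ) ^ m := by
  induction m using Nat.twoStepInduction with
  | zero => simp
  | one =>
    rw [Nat.cast_one, Real.Gamma_add_one (by norm_num), Real.Gamma_one_half_eq]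
    have : √Real.pi ≤ 2 := by
      rw [Real.sqrt_le_left (by norm_num)]; linarith [Real.pi_le_four]
    simp only [Real.sqrt_one, one_pow]
    linarith
  | more m ih _ =>
    have e : ((m + 2 : ℕ) : ℝ) / 2 + 1 = ((m : ℝ) / 2 + 1) + 1 := by push_cast; ring
    rw [e, Real.Gamma_add_one (by positivity), pow_add, Real.sq_sqrt (by positivity), mul_comm]
    have h2 : √(m : ℝ) ^ m ≤ √((m + 2 : ℕ) : ℝ) ^ m := by
      gcongr; simp
    have h3 : (m : ℝ) / 2 + 1 ≤ ((m + 2 : ℕ) : ℝ) := by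
      push_cast
      have : (0 : ℝ) ≤ m := by positivity
      linarith
    gcongr
    exact ih.trans h2

/-- The factor `π^{m/2} ≥ 1` is dropped and the Gamma function bounded crudely. With `R = √m/|z|`
the bound is `|z|^{-m}`, the power that has to cancel in the small ball estimate. -/
theorem le_volume_ball (hm : 0 < m) {R : ℝ} (hR : 0 ≤ R) :
    ENNReal.ofReal ((R / √m) ^ m) ≤
      volume (Metric.ball (0 : EuclideanSpace ℝ (Fin m)) R) := by
  have : Nonempty (Fin m) := ⟨⟨0, hm⟩⟩
  rw [EuclideanSpace.volume_ball, Fintype.card_fin, ← ENNReal.ofReal_pow hR,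
    ← ENNReal.ofReal_mul (by positivity)]
  apply ENNReal.ofReal_le_ofReal
  rw [div_pow, div_eq_mul_one_div]
  have hG : 0 < Real.Gamma ((m : ℝ) / 2 + 1) := Real.Gamma_pos_of_pos (by positivity)
  have hpi : 1 ≤ √Real.pi ^ m := one_le_pow₀ (Real.one_le_sqrt.2 (by linarith [Real.pi_gt_three]))
  gcongr
  exact Gamma_half_add_one_le m

end GaussianWeight

/-! ### Cosine sums and distance to the integer lattice. -/

section Lattice

variable {N : ℕ}

/-- The vector of `ℝ^N` with the given integer coordinates. -/
noncomputable def latticeVec (p : Fin N → ℤ) : EuclideanSpace ℝ (Fin N) :=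
  WithLp.toLp 2 fun i => (p i : ℝ)

/-- `x` is closer than `min (γ ‖x‖) α` to the integer lattice. -/
def NearLattice (γ α : ℝ) (x : EuclideanSpace ℝ (Fin N)) : Prop :=
  ∃ p : Fin N → ℤ, ‖x - latticeVec p‖ < min (γ * ‖x‖) α

theorem sq_sub_round_le_one_sub_cos (x : ℝ) :
    8 * (x - round x) ^ 2 ≤ 1 - Real.cos (2 * Real.pi * x) := by
  have h1 : Real.cos (2 * Real.pi * x) = Real.cos (2 * Real.pi * (x - round x)) := by
    have : 2 * Real.pi * (x - round x) = 2 * Real.pi * x - (round x : ℤ) * (2 * Real.pi) := by ring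
    rw [this, Real.cos_sub_int_mul_two_pi]
  have h2 : |2 * Real.pi * (x - round x)| ≤ Real.pi := by
    rw [abs_mul, abs_of_pos Real.two_pi_pos]
    have := abs_sub_round x
    nlinarith [Real.pi_pos]
  have h3 := Real.cos_le_one_sub_mul_cos_sq h2
  have h4 : 2 / Real.pi ^ 2 * (2 * Real.pi * (x - round x)) ^ 2 = 8 * (x - round x) ^ 2 := by
    field_simp; ring
  rw [h1]
  linarith

/-- Since `1 - cos t = 2 sin²(t/2)` and `|sin|` is subadditive, `√(1 - cos)` obeys a triangle
inequality; squaring it costs the factor 2. -/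
theorem one_sub_cos_sub_le (a b : ℝ) :
    1 - Real.cos (a - b) ≤ 2 * ((1 - Real.cos a) + (1 - Real.cos b)) := by
  have e : ∀ t : ℝ, 1 - Real.cos t = 2 * Real.sin (t / 2) ^ 2 := by
    intro t
    have := Real.cos_sq' (t / 2)
    have h2 := Real.cos_two_mul (t / 2)
    rw [show 2 * (t / 2) = t by ring] at h2
    linarith
  rw [e, e, e, sub_div, Real.sin_sub]
  set s := Real.sin (a / 2)
  set s' := Real.sin (b / 2)
  set c := Real.cos (a / 2)
  set c' := Real.cos (b / 2)
  have hc : c ^ 2 ≤ 1 := Real.cos_sq_le_one _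
  have hc' : c' ^ 2 ≤ 1 := Real.cos_sq_le_one _
  have h1 : (s * c' - c * s') ^ 2 ≤ 2 * ((s * c') ^ 2 + (c * s') ^ 2) := by
    nlinarith [sq_nonneg (s * c' + c * s')]
  have h2 : (s * c') ^ 2 ≤ s ^ 2 := by nlinarith [sq_nonneg s]
  have h3 : (c * s') ^ 2 ≤ s' ^ 2 := by nlinarith [sq_nonneg s']
  linarith

/-- Rounding each coordinate bounds the cosine sum below by 8 times a squared distance to the
lattice. The two exponentials correspond to the two members of the minimum in `NearLattice`. -/
theorem exp_neg_sum_one_sub_cos_le {γ α q : ℝ} (hγ : 0 ≤ γ) (hα : 0 ≤ α) (hq : 0 ≤ q)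
    {x : EuclideanSpace ℝ (Fin N)} (hx : ¬ NearLattice γ α x) :
    Real.exp (-(q / 8 * ∑ k, (1 - Real.cos (2 * Real.pi * x k)))) ≤
      Real.exp (-(q * γ ^ 2) * ‖x‖ ^ 2) + Real.exp (-(q * α ^ 2)) := by
  set p : Fin N → ℤ := fun k => round (x k)
  have h1 : 8 * ‖x - latticeVec p‖ ^ 2 ≤ ∑ k, (1 - Real.cos (2 * Real.pi * x k)) := by
    rw [EuclideanSpace.norm_sq_eq, Finset.mul_sum]
    refine Finset.sum_le_sum fun k _ => ?_
    have := sq_sub_round_le_one_sub_cos (x k)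
    simpa [latticeVec, p] using this
  have h2 : min (γ * ‖x‖) α ≤ ‖x - latticeVec p‖ := by
    by_contra h
    exact hx ⟨p, not_le.1 h⟩
  have h3 : q * ‖x - latticeVec p‖ ^ 2 ≤ q / 8 * ∑ k, (1 - Real.cos (2 * Real.pi * x k)) := by
    nlinarith
  rcases min_le_iff.1 h2 with h | h
  · refine le_add_of_le_of_nonneg (Real.exp_le_exp.2 ?_) (Real.exp_pos _).le
    have : (γ * ‖x‖) ^ 2 ≤ ‖x - latticeVec p‖ ^ 2 := by gcongr
    nlinarith
  · refine le_add_of_nonneg_of_le (Real.exp_pos _).le (Real.exp_le_exp.2 ?_)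
    have : α ^ 2 ≤ ‖x - latticeVec p‖ ^ 2 := by gcongr
    nlinarith

end Lattice

/-! ### Gaussian integrals of the cosine bound. -/

section LevelSets

variable {m N : ℕ}

/-- Inside a small ball the cosine sum has essentially one well: two points where it is small differ
by a vector where it is small too, and such a vector is short because it cannot be near the lattice.
Hence the integrand is below a Gaussian bump plus a constant. -/
theorem lintegral_ball_exp_cos_le
    (A : EuclideanSpace ℝ (Fin m) →ₗᵢ[ℝ] EuclideanSpace ℝ (Fin N)) {γ α q D s R : ℝ}
    (hγ : 0 < γ) (hα : 0 ≤ α) (hq : 0 < q) (hs : s ≠ 0) (hR : 0 < R)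
    (hA : ∀ y, ‖y‖ < D → ¬ NearLattice γ α (A y)) (hsR : |s| * R < Real.pi * D)
    (w : EuclideanSpace ℝ (Fin m)) :
    ∫⁻ y in Metric.ball w R, ENNReal.ofReal
        (Real.exp (-(q / 2 * ∑ k, (1 - Real.cos (s * A y k))))) ≤
      ENNReal.ofReal (√(4 * Real.pi ^ 3 / (q * γ ^ 2 * s ^ 2)) ^ m) +
        ENNReal.ofReal (Real.exp (-(q * α ^ 2))) *
          volume (Metric.ball (0 : EuclideanSpace ℝ (Fin m)) R) := by
  set G : EuclideanSpace ℝ (Fin m) → ℝ := fun y => ∑ k, (1 - Real.cos (s * A y k)) with hG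
  have hAc : Continuous A := A.continuous
  have hGc : Continuous G := by
    refine continuous_finsetSum _ fun k _ => ?_
    have : Continuous fun y => A y k := (EuclideanSpace.proj k).continuous.comp hAc
    fun_prop
  -- The bump is centred at a minimizer `y0` of `G`: then `G(y - y0) ≤ 2(G y + G y0) ≤ 4 G y`, which
  -- turns `q/2` into the `q/8` of `exp_neg_sum_one_sub_cos_le`.
  obtain ⟨y0, hy0, hmin⟩ := (isCompact_closedBall w R).exists_isMinOn
    ⟨w, Metric.mem_closedBall_self hR.le⟩ hGc.continuousOn
  set b := q * γ ^ 2 * (s / (2 * Real.pi)) ^ 2 with hb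
  have hb0 : 0 < b := by have := Real.pi_pos; positivity
  have hpt : ∀ y ∈ Metric.ball w R, Real.exp (-(q / 2 * G y)) ≤
      Real.exp (-b * ‖y - y0‖ ^ 2) + Real.exp (-(q * α ^ 2)) := by
    intro y hy
    have h1 : G y0 ≤ G y := hmin (Metric.ball_subset_closedBall hy)
    have h2 : G (y - y0) ≤ 2 * (G y + G y0) := by
      simp only [hG]
      rw [← Finset.sum_add_distrib, Finset.mul_sum]
      refine Finset.sum_le_sum fun k _ => ?_
      have := one_sub_cos_sub_le (s * A y k) (s * A y0 k)
      rwa [map_sub, PiLp.sub_apply, mul_sub]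
    have hx : ¬ NearLattice γ α ((s / (2 * Real.pi)) • A (y - y0)) := by
      rw [← map_smul]
      apply hA
      rw [norm_smul, Real.norm_eq_abs, abs_div, abs_of_pos Real.two_pi_pos]
      have h3 : ‖y - y0‖ ≤ 2 * R := by
        rw [← dist_eq_norm]
        have := dist_triangle_right y y0 w
        have := Metric.mem_ball.1 hy
        have := Metric.mem_closedBall.1 hy0
        linarith
      rw [div_mul_eq_mul_div, div_lt_iff₀ Real.two_pi_pos]
      nlinarith [abs_nonneg s]
    have h4 := exp_neg_sum_one_sub_cos_le hγ.le hα hq.le hx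
    have h5 : ∑ k, (1 - Real.cos (2 * Real.pi * ((s / (2 * Real.pi)) • A (y - y0)) k)) =
        G (y - y0) := by
      refine Finset.sum_congr rfl fun k _ => ?_
      rw [PiLp.smul_apply, smul_eq_mul]
      congr 2
      have := Real.pi_pos
      field_simp
    rw [h5, norm_smul, mul_pow, Real.norm_eq_abs, sq_abs, LinearIsometry.norm_map] at h4
    refine le_trans (Real.exp_le_exp.2 ?_) (h4.trans_eq ?_)
    · nlinarith
    · congr 2; rw [hb]; ring
  calc ∫⁻ y in Metric.ball w R, ENNReal.ofReal (Real.exp (-(q / 2 * G y)))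
      ≤ ∫⁻ y in Metric.ball w R, (ENNReal.ofReal (Real.exp (-b * ‖y - y0‖ ^ 2)) +
          ENNReal.ofReal (Real.exp (-(q * α ^ 2)))) := by
        refine setLIntegral_mono' measurableSet_ball fun y hy => ?_
        rw [← ENNReal.ofReal_add (Real.exp_pos _).le (Real.exp_pos _).le]
        exact ENNReal.ofReal_le_ofReal (hpt y hy)
    _ = (∫⁻ y in Metric.ball w R, ENNReal.ofReal (Real.exp (-b * ‖y - y0‖ ^ 2))) +
        ENNReal.ofReal (Real.exp (-(q * α ^ 2))) *
          volume (Metric.ball (0 : EuclideanSpace ℝ (Fin m)) R) := by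
        rw [lintegral_add_left (by fun_prop), setLIntegral_const,
          Measure.addHaar_ball_center]
    _ ≤ _ := by
        gcongr
        calc ∫⁻ y in Metric.ball w R, ENNReal.ofReal (Real.exp (-b * ‖y - y0‖ ^ 2))
            ≤ ∫⁻ y, ENNReal.ofReal (Real.exp (-b * ‖y - y0‖ ^ 2)) := setLIntegral_le_lintegral _ _
          _ = ∫⁻ y : EuclideanSpace ℝ (Fin m), ENNReal.ofReal (Real.exp (-b * ‖y‖ ^ 2)) :=
            lintegral_sub_right_eq_self
              (fun y : EuclideanSpace ℝ (Fin m) => ENNReal.ofReal (Real.exp (-b * ‖y‖ ^ 2))) y0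
          _ = ENNReal.ofReal (∫ y : EuclideanSpace ℝ (Fin m), Real.exp (-b * ‖y‖ ^ 2)) := by
            rw [ofReal_integral_eq_lintegral_ofReal _
              (Filter.Eventually.of_forall fun _ => (Real.exp_pos _).le)]
            have := (GaussianFourier.integrable_cexp_neg_mul_sq_norm_add
              (V := EuclideanSpace ℝ (Fin m)) (b := (b : ℂ)) (by simpa using hb0) 0 0).norm
            refine this.congr (Filter.Eventually.of_forall fun y => ?_)
            simp only [Complex.norm_exp]
            congr 1
            simp [← Complex.ofReal_pow]
          _ ≤ _ := by
            apply ENNReal.ofReal_le_ofReal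
            rw [GaussianFourier.integral_rexp_neg_mul_sq_norm hb0, finrank_euclideanSpace,
              Fintype.card_fin]
            have : Real.pi / b = 4 * Real.pi ^ 3 / (q * γ ^ 2 * s ^ 2) := by
              rw [hb]
              have := Real.pi_pos
              field_simp
              ring
            have hQ : 0 ≤ 4 * Real.pi ^ 3 / (q * γ ^ 2 * s ^ 2) := by
              have := Real.pi_pos
              positivity
            rw [this, Real.rpow_div_two_eq_sqrt _ hQ, Real.rpow_natCast]

/-- The constant in the small ball estimate. -/
noncomputable def ballConst (γ q : ℝ) : ℝ := √(4 * Real.pi ^ 3 / (q * γ ^ 2))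

/-- The bound must be uniform in `z`, which will be a value of the symmetrized coordinate
conditioned on `|z| ≥ 1`. -/
theorem integral_gaussVec_exp_cos_le (hm : 0 < m)
    (A : EuclideanSpace ℝ (Fin m) →ₗᵢ[ℝ] EuclideanSpace ℝ (Fin N)) {γ α q D ε z : ℝ}
    (hγ : 0 < γ) (hα : 0 ≤ α) (hq : 0 < q) (hε : 0 < ε) (hz : 1 ≤ |z|)
    (hA : ∀ y, ‖y‖ < D → ¬ NearLattice γ α (A y)) (hD : √(m : ℝ) ≤ ε * D) :
    ∫ y, Real.exp (-(q / 2 * ∑ k, (1 - Real.cos (z / ε * A y k)))) ∂(gaussVec m) ≤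
      Real.exp (m / 2) * ((ballConst γ q * ε) ^ m + Real.exp (-(q * α ^ 2))) := by
  have hmr : (0 : ℝ) < m := by exact_mod_cast hm
  have hsm : 0 < √(m : ℝ) := Real.sqrt_pos.2 hmr
  have hz0 : 0 < |z| := by linarith
  have hzne : z ≠ 0 := abs_pos.1 hz0
  -- This radius makes the frequency times `R` equal to `√m/ε ≤ D`. The bump has mass `(Cε/|z|)^m`
  -- and the ball has volume at least `|z|^{-m}`, so `z` drops out; `|z| ≥ 1` keeps `exp(-R²/2) ≥
  -- e^{-m/2}`.
  set R := √(m : ℝ) / |z| with hRdef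
  have hR : 0 < R := by positivity
  have hRle : R ≤ √(m : ℝ) := div_le_self hsm.le hz
  have hD0 : 0 < D := by
    by_contra h
    nlinarith
  have hsR : |z / ε| * R < Real.pi * D := by
    have : |z / ε| * R = √(m : ℝ) / ε := by
      rw [hRdef, abs_div, abs_of_pos hε]; field_simp
    rw [this, div_lt_iff₀ hε]
    nlinarith [Real.pi_gt_three, mul_pos hε hD0]
  set F : EuclideanSpace ℝ (Fin m) → ℝ := fun y =>
    Real.exp (-(q / 2 * ∑ k, (1 - Real.cos (z / ε * A y k)))) with hF
  have hFc : Continuous F := by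
    have : ∀ k, Continuous fun y => A y k := fun k =>
      (EuclideanSpace.proj k).continuous.comp A.continuous
    fun_prop
  have h1 := lintegral_gaussVec_le (F := fun y => ENNReal.ofReal (F y))
    hFc.measurable.ennreal_ofReal
    (lintegral_ball_exp_cos_le A hγ hα hq (div_ne_zero hzne hε.ne') hR hA hsR)
  set V := volume (Metric.ball (0 : EuclideanSpace ℝ (Fin m)) R) with hV
  have hVfin : V ≠ ⊤ := measure_ball_lt_top.ne
  have hVge := le_volume_ball hm hR.le
  set v := V.toReal with hv
  have hvV : V = ENNReal.ofReal v := (ENNReal.ofReal_toReal hVfin).symm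
  have hvge : (1 / |z|) ^ m ≤ v := by
    have : R / √(m : ℝ) = 1 / |z| := by rw [hRdef]; field_simp
    rw [this, ← hV, hvV] at hVge
    exact (ENNReal.ofReal_le_ofReal_iff ENNReal.toReal_nonneg).1 hVge
  have hv0 : 0 < v := lt_of_lt_of_le (by positivity) hvge
  have hFi : Integrable F (gaussVec m) := by
    refine (integrable_const (1 : ℝ)).mono' hFc.aestronglyMeasurable
      (Filter.Eventually.of_forall fun y => ?_)
    rw [Real.norm_of_nonneg (Real.exp_pos _).le]
    refine Real.exp_le_one_iff.2 (neg_nonpos.2 (mul_nonneg (by positivity) ?_))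
    exact Finset.sum_nonneg fun k _ => sub_nonneg.2 (Real.cos_le_one _)
  set I := ∫ y, F y ∂(gaussVec m) with hI
  have hI0 : 0 ≤ I := integral_nonneg fun _ => (Real.exp_pos _).le
  rw [← ofReal_integral_eq_lintegral_ofReal hFi
    (Filter.Eventually.of_forall fun _ => (Real.exp_pos _).le), ← hI, hvV,
    ← ENNReal.ofReal_mul (Real.exp_pos _).le, ← ENNReal.ofReal_mul hI0,
    ← ENNReal.ofReal_mul (Real.exp_pos _).le, ← ENNReal.ofReal_add (by positivity) (by positivity),
    ENNReal.ofReal_le_ofReal_iff (by positivity)] at h1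
  have ha : √(4 * Real.pi ^ 3 / (q * γ ^ 2 * (z / ε) ^ 2)) ^ m =
      (ballConst γ q * ε) ^ m * (1 / |z|) ^ m := by
    rw [← mul_pow, ballConst]
    congr 1
    have : 4 * Real.pi ^ 3 / (q * γ ^ 2 * (z / ε) ^ 2) =
      4 * Real.pi ^ 3 / (q * γ ^ 2) * (ε / |z|) ^ 2 := by
      rw [div_pow ε, sq_abs]
      field_simp
    rw [this, Real.sqrt_mul (by have := Real.pi_pos; positivity), Real.sqrt_sq (by positivity)]
    ring
  rw [ha] at h1
  have hb0 : 0 ≤ ballConst γ q := Real.sqrt_nonneg _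
  have h2 : I * Real.exp (-R ^ 2 / 2) ≤ (ballConst γ q * ε) ^ m + Real.exp (-(q * α ^ 2)) := by
    refine le_of_mul_le_mul_right ?_ hv0
    calc I * Real.exp (-R ^ 2 / 2) * v = I * (Real.exp (-R ^ 2 / 2) * v) := by ring
      _ ≤ _ := h1
      _ ≤ (ballConst γ q * ε) ^ m * v + Real.exp (-(q * α ^ 2)) * v := by gcongr
      _ = _ := by ring
  have h3 : Real.exp (-(m / 2 : ℝ)) ≤ Real.exp (-R ^ 2 / 2) := by
    apply Real.exp_le_exp.2
    have : R ^ 2 ≤ m := by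
      rw [← Real.sq_sqrt hmr.le]; gcongr
    linarith
  calc I = Real.exp (m / 2) * (I * Real.exp (-(m / 2 : ℝ))) := by
        rw [mul_left_comm, ← Real.exp_add]; simp
    _ ≤ Real.exp (m / 2) * (I * Real.exp (-R ^ 2 / 2)) := by gcongr
    _ ≤ _ := by gcongr

end LevelSets

/-! ### Characteristic functions and the small ball estimate. -/

/-- Symmetrization: `|φ(t)|²` is the mean of `cos(t(ξ - ξ'))` for independent copies, and `r² ≤
exp(-(1 - r²))`. -/
theorem norm_charFun_le_exp (P : Measure ℝ) [IsProbabilityMeasure P] (t : ℝ) :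
    ‖charFun P t‖ ≤
      Real.exp (-(1 / 2) * ∫ p, (1 - Real.cos (t * (p.1 - p.2))) ∂(P.prod P)) := by
  have hint : Integrable (fun p : ℝ × ℝ => Real.cos (t * (p.1 - p.2))) (P.prod P) :=
    (integrable_const (1 : ℝ)).mono' (by fun_prop)
      (Filter.Eventually.of_forall fun p => by simpa using Real.abs_cos_le_one _)
  have hintc : Integrable (fun p : ℝ × ℝ => Complex.exp ((t * (p.1 - p.2) : ℝ) * Complex.I))
      (P.prod P) :=
    (integrable_const (1 : ℝ)).mono' (by fun_prop)
      (Filter.Eventually.of_forall fun p => by rw [Complex.norm_exp_ofReal_mul_I])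
  have h1 : charFun P t * charFun P (-t) =
      ∫ p, Complex.exp ((t * (p.1 - p.2) : ℝ) * Complex.I) ∂(P.prod P) := by
    rw [charFun_apply_real, charFun_apply_real, ← integral_prod_mul]
    refine integral_congr_ae (Filter.Eventually.of_forall fun p => ?_)
    simp only
    rw [← Complex.exp_add]
    congr 1
    push_cast
    ring
  have h2 : ‖charFun P t‖ ^ 2 = ∫ p, Real.cos (t * (p.1 - p.2)) ∂(P.prod P) := by
    have h3 := congrArg Complex.re h1
    rw [charFun_neg, Complex.mul_conj, Complex.ofReal_re, Complex.normSq_eq_norm_sq] at h3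
    rw [h3]
    have := Complex.reCLM.integral_comp_comm hintc
    simp only [Complex.reCLM_apply, Complex.exp_ofReal_mul_I_re] at this
    exact this.symm
  have h4 : ∫ p, (1 - Real.cos (t * (p.1 - p.2))) ∂(P.prod P) = 1 - ‖charFun P t‖ ^ 2 := by
    rw [integral_sub (integrable_const _) hint, h2]; simp
  rw [h4]
  refine le_of_sq_le_sq ?_ (Real.exp_pos _).le
  rw [← Real.exp_nat_mul]
  have := Real.add_one_le_exp (((2 : ℕ) : ℝ) * (-(1 / 2) * (1 - ‖charFun P t‖ ^ 2)))
  push_cast at this ⊢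
  linarith

/-- Restricting the mean of the nonnegative cosine sum to `|ξ - ξ'| ≥ 1` costs the factor `q`.
Jensen then moves the conditional mean outside the exponential, so that the difference can be fixed
when the Gaussian variable is integrated. -/
theorem prod_norm_charFun_le (P : Measure ℝ) [IsProbabilityMeasure P] {q : ℝ} (hq : 0 < q)
    (hP : q ≤ (P.prod P).real {p | 1 ≤ |p.1 - p.2|}) {N : ℕ} (t : Fin N → ℝ) :
    ∏ k, ‖charFun P (t k)‖ ≤
      ∫ p, Real.exp (-(q / 2 * ∑ k, (1 - Real.cos ((p.1 - p.2) * t k))))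
        ∂((P.prod P)[|{p | 1 ≤ |p.1 - p.2|}]) := by
  set S : Set (ℝ × ℝ) := {p | 1 ≤ |p.1 - p.2|} with hS
  have hSm : MeasurableSet S := measurableSet_le measurable_const (by fun_prop)
  have hSpos : (P.prod P) S ≠ 0 := by
    intro h
    rw [measureReal_def, h] at hP
    simp at hP
    linarith
  set κ := (P.prod P)[|S] with hκ
  have : IsProbabilityMeasure κ := cond_isProbabilityMeasure hSpos
  set G : ℝ × ℝ → ℝ := fun p => ∑ k, (1 - Real.cos ((p.1 - p.2) * t k)) with hG
  have hGc : Continuous G := by fun_prop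
  have hG0 : ∀ p, 0 ≤ G p := fun p =>
    Finset.sum_nonneg fun k _ => sub_nonneg.2 (Real.cos_le_one _)
  have hGb : ∀ p, ‖G p‖ ≤ 2 * N := fun p => by
    rw [Real.norm_of_nonneg (hG0 p)]
    calc G p ≤ ∑ _k : Fin N, (2 : ℝ) := Finset.sum_le_sum fun k _ => by
          have := Real.neg_one_le_cos ((p.1 - p.2) * t k); linarith
      _ = 2 * N := by simp [mul_comm]
  have hGi : ∀ ν : Measure (ℝ × ℝ), IsProbabilityMeasure ν → Integrable G ν := fun ν _ =>
    (integrable_const (2 * (N : ℝ))).mono' hGc.aestronglyMeasurable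
      (Filter.Eventually.of_forall hGb)
  have h1 : ∏ k, ‖charFun P (t k)‖ ≤ Real.exp (-(1 / 2) * ∫ p, G p ∂(P.prod P)) := by
    calc ∏ k, ‖charFun P (t k)‖ ≤ ∏ k, Real.exp (-(1 / 2) *
          ∫ p, (1 - Real.cos (t k * (p.1 - p.2))) ∂(P.prod P)) :=
          Finset.prod_le_prod (fun k _ => norm_nonneg _) fun k _ => norm_charFun_le_exp P (t k)
      _ = _ := by
        rw [← Real.exp_sum, ← Finset.mul_sum, hG, integral_finsetSum]
        · simp_rw [mul_comm]
        · intro k _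
          exact (integrable_const (2 : ℝ)).mono' (by fun_prop)
            (Filter.Eventually.of_forall fun p => by
              rw [Real.norm_of_nonneg (sub_nonneg.2 (Real.cos_le_one _))]
              have := Real.neg_one_le_cos ((p.1 - p.2) * t k); linarith)
  have h2 : q * ∫ p, G p ∂κ ≤ ∫ p, G p ∂(P.prod P) := by
    have e : ∫ p in S, G p ∂(P.prod P) = (P.prod P).real S * ∫ p, G p ∂κ := by
      rw [hκ, ProbabilityTheory.cond, integral_smul_measure, ENNReal.toReal_inv, ← measureReal_def, smul_eq_mul,
        mul_inv_cancel_left₀ (by linarith)]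
    calc q * ∫ p, G p ∂κ ≤ (P.prod P).real S * ∫ p, G p ∂κ := by
          gcongr; exact integral_nonneg hG0
      _ = ∫ p in S, G p ∂(P.prod P) := e.symm
      _ ≤ _ := setIntegral_le_integral (hGi _ inferInstance) (Filter.Eventually.of_forall hG0)
  have h3 : Real.exp (∫ p, -(q / 2 * G p) ∂κ) ≤ ∫ p, Real.exp (-(q / 2 * G p)) ∂κ := by
    refine convexOn_exp.map_integral_le Real.continuous_exp.continuousOn isClosed_univ
      (by simp) ((hGi κ inferInstance).const_mul _).neg ?_
    refine (integrable_const (1 : ℝ)).mono' (by fun_prop)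
      (Filter.Eventually.of_forall fun p => ?_)
    simp only [Function.comp]
    rw [Real.norm_of_nonneg (Real.exp_pos _).le]
    exact Real.exp_le_one_iff.2 (neg_nonpos.2 (mul_nonneg (by positivity) (hG0 p)))
  refine h1.trans (le_trans (Real.exp_le_exp.2 ?_) h3)
  rw [integral_neg, integral_const_mul]
  linarith

theorem IsIIDSubgaussian.measurable_vec {Ω : Type*} [MeasurableSpace Ω] {μ : Measure Ω} {N : ℕ}
    {B : ℝ} {X : Ω → EuclideanSpace ℝ (Fin N)}
    (hX : IsIIDSubgaussian B (fun (i : Fin N) (ω : Ω) => X ω i) μ) : Measurable X := by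
  have : Measurable fun ω => WithLp.toLp 2 (fun i => X ω i) :=
    (PiLp.continuous_toLp 2 _).measurable.comp (measurable_pi_lambda _ hX.measurable)
  exact this

/-- The constant `q` in the decay `exp (-q α²)` for coordinates of subgaussian moment `B`. -/
noncomputable def symMass (B : ℝ) : ℝ := 1 / (600 * B ^ 4)

theorem symMass_pos {B : ℝ} (hB : 0 < B) : 0 < symMass B := by unfold symMass; positivity

/-- Small ball estimate for the projection of `X` to a subspace far from the integer lattice. -/
theorem IsIIDSubgaussian.small_ball {Ω : Type*} [MeasurableSpace Ω] {μ : Measure Ω}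
    [IsProbabilityMeasure μ] {m N : ℕ} (hm : 0 < m) {B : ℝ} (hB : 0 < B)
    {X : Ω → EuclideanSpace ℝ (Fin N)}
    (hX : IsIIDSubgaussian B (fun (i : Fin N) (ω : Ω) => X ω i) μ)
    (A : EuclideanSpace ℝ (Fin m) →ₗᵢ[ℝ] EuclideanSpace ℝ (Fin N)) {γ α D ε : ℝ}
    (hγ : 0 < γ) (hα : 0 ≤ α) (hε : 0 < ε)
    (hA : ∀ y, ‖y‖ < D → ¬ NearLattice γ α (A y)) (hD : √(m : ℝ) ≤ ε * D)
    (v : EuclideanSpace ℝ (Fin m)) :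
    ∫ ω, Real.exp (-‖A.toContinuousLinearMap.adjoint (X ω) - v‖ ^ 2 / (2 * ε ^ 2)) ∂μ ≤
      Real.exp (m / 2) * ((ballConst γ (symMass B) * ε) ^ m +
        Real.exp (-(symMass B * α ^ 2))) := by
  have hXm := hX.measurable_vec
  have hN : 0 < N := by
    rcases Nat.eq_zero_or_pos N with rfl | h
    · exfalso
      have h1 := A.norm_map (EuclideanSpace.single ⟨0, hm⟩ (1 : ℝ))
      rw [Subsingleton.elim (A _) 0] at h1
      simp at h1
    · exact h
  set i0 : Fin N := ⟨0, hN⟩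
  set P : Measure ℝ := μ.map (fun ω => X ω i0) with hP
  have : IsProbabilityMeasure P := Measure.isProbabilityMeasure_map (hX.measurable i0).aemeasurable
  have hPk : ∀ k, μ.map (fun ω => X ω k) = P := fun k => (hX.identDistrib k i0).map_eq
  set q := symMass B with hq
  have hq0 : 0 < q := symMass_pos hB
  have hmass : q ≤ (P.prod P).real {p | 1 ≤ |p.1 - p.2|} := by
    have h := (hX.subgaussian i0).symm_mass (hX.measurable i0) (hX.mean_zero i0)
      (hX.unit_variance i0)
    rw [hP, Measure.map_prod_map _ _ (hX.measurable i0) (hX.measurable i0), map_measureReal_apply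
      ((hX.measurable i0).prodMap (hX.measurable i0))
      (measurableSet_le measurable_const (by fun_prop))]
    exact h
  set κ := (P.prod P)[|{p | 1 ≤ |p.1 - p.2|}] with hκ
  have hSpos : (P.prod P) {p | 1 ≤ |p.1 - p.2|} ≠ 0 := by
    intro h
    rw [measureReal_def, h] at hmass
    simp at hmass
    linarith
  have : IsProbabilityMeasure κ := cond_isProbabilityMeasure hSpos
  set w : Ω → EuclideanSpace ℝ (Fin m) :=
    fun ω => ε⁻¹ • (A.toContinuousLinearMap.adjoint (X ω) - v) with hw
  have hwm : Measurable w :=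
    ((A.toContinuousLinearMap.adjoint.continuous.measurable.comp hXm).sub_const v).const_smul ε⁻¹
  have hinner : ∀ g ω, inner ℝ g (w ω) =
      -(ε⁻¹ * inner ℝ g v) + ∑ k, ε⁻¹ * A g k * X ω k := by
    intro g ω
    rw [hw]
    simp only
    rw [inner_smul_right, inner_sub_right, ContinuousLinearMap.adjoint_inner_right,
      PiLp.inner_apply, mul_sub, Finset.mul_sum, sub_eq_neg_add]
    congr 1
    refine Finset.sum_congr rfl fun k _ => ?_
    simp
    ring
  have hchar : ∀ g, ‖∫ ω, Complex.exp ((inner ℝ g (w ω) : ℝ) * Complex.I) ∂μ‖ =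
      ∏ k, ‖charFun P (ε⁻¹ * A g k)‖ := by
    intro g
    have h1 : ∀ ω, Complex.exp ((inner ℝ g (w ω) : ℝ) * Complex.I) =
        Complex.exp ((-(ε⁻¹ * inner ℝ g v) : ℝ) * Complex.I) *
          ∏ k, Complex.exp ((ε⁻¹ * A g k : ℝ) * (X ω k : ℝ) * Complex.I) := by
      intro ω
      rw [← Complex.exp_sum, ← Complex.exp_add, hinner, ← Finset.sum_mul]
      congr 1
      push_cast
      ring
    simp_rw [h1]
    rw [integral_const_mul, norm_mul, Complex.norm_exp_ofReal_mul_I, one_mul]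
    have h2 := hX.indep.integral_fun_prod_comp (fun k => (hX.measurable k).aemeasurable)
      (f := fun k x => Complex.exp ((ε⁻¹ * A g k : ℝ) * (x : ℝ) * Complex.I))
      (fun k => by fun_prop)
    rw [h2, norm_prod]
    refine Finset.prod_congr rfl fun k _ => ?_
    rw [charFun_apply_real, ← hPk k, integral_map (hX.measurable k).aemeasurable (by fun_prop)]
  have hjoint : Integrable (fun p : Ω × EuclideanSpace ℝ (Fin m) =>
      Complex.exp ((inner ℝ p.2 (w p.1) : ℝ) * Complex.I)) (μ.prod (gaussVec m)) := by
    refine (integrable_const (1 : ℝ)).mono' ?_ (Filter.Eventually.of_forall fun p => by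
      rw [Complex.norm_exp_ofReal_mul_I])
    refine Measurable.aestronglyMeasurable ?_
    have : Measurable fun p : Ω × EuclideanSpace ℝ (Fin m) => inner ℝ p.2 (w p.1) :=
      measurable_snd.inner (hwm.comp measurable_fst)
    fun_prop
  -- A Gaussian substitute for Esseen's inequality: `exp(-‖w‖²/2)` is the Gaussian mean of `exp(i⟨g,
  -- w⟩)`, and Fubini lets `X` be averaged first.
  have hmain : ∫ ω, Real.exp (-‖w ω‖ ^ 2 / 2) ∂μ ≤
      ∫ g, ∏ k, ‖charFun P (ε⁻¹ * A g k)‖ ∂(gaussVec m) := by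
    have h1 : ((∫ ω, Real.exp (-‖w ω‖ ^ 2 / 2) ∂μ : ℝ) : ℂ) =
        ∫ g, ∫ ω, Complex.exp ((inner ℝ g (w ω) : ℝ) * Complex.I) ∂μ ∂(gaussVec m) := by
      rw [← integral_complex_ofReal, ← integral_integral_swap hjoint]
      refine integral_congr_ae (Filter.Eventually.of_forall fun ω => ?_)
      simp only
      rw [← charFun_gaussVec, charFun_apply]
    have h2 : ∫ ω, Real.exp (-‖w ω‖ ^ 2 / 2) ∂μ =
        ‖((∫ ω, Real.exp (-‖w ω‖ ^ 2 / 2) ∂μ : ℝ) : ℂ)‖ := by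
      rw [Complex.norm_real, Real.norm_of_nonneg]
      exact integral_nonneg fun _ => (Real.exp_pos _).le
    rw [h2, h1]
    refine (norm_integral_le_integral_norm _).trans_eq ?_
    simp_rw [hchar]
  have hLHS : ∀ ω, Real.exp (-‖A.toContinuousLinearMap.adjoint (X ω) - v‖ ^ 2 / (2 * ε ^ 2)) =
      Real.exp (-‖w ω‖ ^ 2 / 2) := by
    intro ω
    congr 1
    simp only [hw]
    rw [norm_smul, Real.norm_eq_abs, mul_pow, sq_abs]
    field_simp
  simp_rw [hLHS]
  have hAk : ∀ k, Continuous fun y => A y k := fun k =>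
    (EuclideanSpace.proj k).continuous.comp A.continuous
  have hnn : ∀ (z : ℝ) (g : EuclideanSpace ℝ (Fin m)),
      Real.exp (-(q / 2 * ∑ k, (1 - Real.cos (z * (ε⁻¹ * A g k))))) ≤ 1 := fun z g => by
    refine Real.exp_le_one_iff.2 (neg_nonpos.2 (mul_nonneg (by positivity) ?_))
    exact Finset.sum_nonneg fun k _ => sub_nonneg.2 (Real.cos_le_one _)
  have hjoint2 : Integrable (fun r : EuclideanSpace ℝ (Fin m) × (ℝ × ℝ) =>
      Real.exp (-(q / 2 * ∑ k, (1 - Real.cos ((r.2.1 - r.2.2) * (ε⁻¹ * A r.1 k))))))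
      ((gaussVec m).prod κ) := by
    refine (integrable_const (1 : ℝ)).mono' ?_ (Filter.Eventually.of_forall fun p => by
      rw [Real.norm_of_nonneg (Real.exp_pos _).le]; exact hnn _ _)
    refine Continuous.aestronglyMeasurable ?_
    fun_prop
  have hcharc : Continuous fun g => ∏ k, ‖charFun P (ε⁻¹ * A g k)‖ := by
    have := (continuous_charFun (μ := P))
    fun_prop
  calc ∫ ω, Real.exp (-‖w ω‖ ^ 2 / 2) ∂μ
      ≤ ∫ g, ∏ k, ‖charFun P (ε⁻¹ * A g k)‖ ∂(gaussVec m) := hmain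
    _ ≤ ∫ g, ∫ p, Real.exp (-(q / 2 * ∑ k, (1 - Real.cos ((p.1 - p.2) * (ε⁻¹ * A g k)))))
          ∂κ ∂(gaussVec m) := by
        refine integral_mono ?_ hjoint2.integral_prod_left fun g => ?_
        · refine (integrable_const (1 : ℝ)).mono' hcharc.aestronglyMeasurable
            (Filter.Eventually.of_forall fun g => ?_)
          rw [Real.norm_of_nonneg (Finset.prod_nonneg fun k _ => norm_nonneg _)]
          exact Finset.prod_le_one (fun k _ => norm_nonneg _) fun k _ => norm_charFun_le_one _
        · exact prod_norm_charFun_le P hq0 hmass fun k => ε⁻¹ * A g k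
    _ = ∫ p, ∫ g, Real.exp (-(q / 2 * ∑ k, (1 - Real.cos ((p.1 - p.2) * (ε⁻¹ * A g k)))))
          ∂(gaussVec m) ∂κ := integral_integral_swap hjoint2
    _ ≤ ∫ _p, Real.exp (m / 2) * ((ballConst γ q * ε) ^ m + Real.exp (-(q * α ^ 2))) ∂κ := by
        refine integral_mono_ae hjoint2.integral_prod_right (integrable_const _) ?_
        filter_upwards [ae_cond_mem (measurableSet_le measurable_const (by fun_prop))] with p hp
        have h := integral_gaussVec_exp_cos_le hm A hγ hα hq0 hε
          (z := p.1 - p.2) hp hA hD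
        refine le_trans (le_of_eq ?_) h
        congr 1
        ext g
        congr 4
        ext k
        congr 2
        rw [div_eq_mul_inv, mul_assoc]
    _ = _ := by simp

/-! ### Counting lattice points in balls. -/

section Counting

variable {N : ℕ}

theorem abs_le_norm_latticeVec (p : Fin N → ℤ) (k : Fin N) : |(p k : ℝ)| ≤ ‖latticeVec p‖ := by
  have := PiLp.norm_apply_le (latticeVec p) k
  simpa [latticeVec] using this

theorem sum_abs_le_norm_latticeVec (p : Fin N → ℤ) :
    ∑ k, |(p k : ℝ)| ≤ √(N : ℝ) * ‖latticeVec p‖ := by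
  have h := sq_sum_le_card_mul_sum_sq (s := Finset.univ) (f := fun k => |(p k : ℝ)|)
  refine le_of_sq_le_sq ?_ (by positivity)
  rw [mul_pow, Real.sq_sqrt (by positivity), EuclideanSpace.norm_sq_eq]
  simpa [latticeVec] using h

/-- The integer points in the ball of radius `r √N`. -/
noncomputable def latticeBall (N : ℕ) (r : ℝ) : Finset (Fin N → ℤ) :=
  (Fintype.piFinset fun _ : Fin N => Finset.Icc (-⌈r * √(N : ℝ)⌉) ⌈r * √(N : ℝ)⌉).filter
    fun p => ‖latticeVec p‖ ≤ r * √(N : ℝ)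

theorem mem_latticeBall {r : ℝ} {p : Fin N → ℤ} :
    p ∈ latticeBall N r ↔ ‖latticeVec p‖ ≤ r * √(N : ℝ) := by
  classical
  rw [latticeBall, Finset.mem_filter, and_iff_right_iff_imp]
  intro h
  rw [Fintype.mem_piFinset]
  intro k
  rw [Finset.mem_Icc, ← abs_le]
  have := ((abs_le_norm_latticeVec p k).trans h).trans (Int.le_ceil _)
  exact_mod_cast this

theorem sum_Icc_exp_neg_abs_le {l : ℝ} (hl : 0 < l) (s : Finset ℤ) :
    ∑ j ∈ s, Real.exp (-(l * |(j : ℝ)|)) ≤ 1 + 2 / l := by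
  set x := Real.exp (-l) with hx
  have hx0 : 0 < x := Real.exp_pos _
  have hx1 : x < 1 := by rw [hx, Real.exp_lt_one_iff]; linarith
  have h1 : HasSum (fun n : ℕ => Real.exp (-(l * |(((n : ℕ) : ℤ) : ℝ)|))) (1 - x)⁻¹ := by
    convert! hasSum_geometric_of_lt_one hx0.le hx1 using 2 with n
    rw [hx, ← Real.exp_nat_mul]
    congr 1
    simp
    ring
  have h2 : HasSum (fun n : ℕ => Real.exp (-(l * |((-((n : ℤ) + 1) : ℤ) : ℝ)|)))
      (x * (1 - x)⁻¹) := by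
    convert! (hasSum_geometric_of_lt_one hx0.le hx1).mul_left x using 2 with n
    rw [hx, ← Real.exp_nat_mul, ← Real.exp_add]
    congr 1
    have : |((-((n : ℤ) + 1) : ℤ) : ℝ)| = n + 1 := by
      push_cast
      rw [abs_neg, abs_of_nonneg (by positivity)]
    rw [this]
    ring
  have h3 := HasSum.of_nat_of_neg_add_one (f := fun j : ℤ => Real.exp (-(l * |(j : ℝ)|))) h1 h2
  refine (sum_le_hasSum s (fun _ _ => (Real.exp_pos _).le) h3).trans ?_
  have h4 : x * (1 + l) ≤ 1 := by
    have := Real.add_one_le_exp l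
    calc x * (1 + l) ≤ x * Real.exp l := by gcongr; linarith
      _ = 1 := by rw [hx, ← Real.exp_add]; simp
  have h5 : (1 - x)⁻¹ + x * (1 - x)⁻¹ = 1 + 2 * x / (1 - x) := by
    have : 1 - x ≠ 0 := by linarith
    field_simp
    ring
  have h6 : 2 * x / (1 - x) ≤ 2 / l := by
    rw [div_le_div_iff₀ (by linarith) hl]
    nlinarith
  rw [h5]
  linarith

/-- Exponential weights: points of the ball have `ℓ¹` norm at most `rN`, and the weight
`exp(-l‖p‖₁)` sums as a product. The free `l` serves both large radii, giving `(Cr)^N`, and tiny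
ones, giving `e^{δN}` with small `δ`. -/
theorem card_latticeBall_le (r : ℝ) {l : ℝ} (hl : 0 < l) :
    ((latticeBall N r).card : ℝ) ≤ (Real.exp (l * r) * (1 + 2 / l)) ^ N := by
  classical
  set s := Finset.Icc (-⌈r * √(N : ℝ)⌉) ⌈r * √(N : ℝ)⌉ with hs
  have h1 : ∀ p ∈ latticeBall N r,
      (1 : ℝ) ≤ Real.exp (l * r) ^ N * ∏ k, Real.exp (-(l * |(p k : ℝ)|)) := by
    intro p hp
    rw [← Real.exp_nat_mul, ← Real.exp_sum, ← Real.exp_add, Finset.sum_neg_distrib,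
      ← Finset.mul_sum]
    apply Real.one_le_exp
    have h2 := sum_abs_le_norm_latticeVec p
    have h3 : √(N : ℝ) * ‖latticeVec p‖ ≤ √(N : ℝ) * (r * √(N : ℝ)) := by
      gcongr; exact mem_latticeBall.1 hp
    have h4 : √(N : ℝ) * (r * √(N : ℝ)) = r * N := by
      rw [mul_left_comm, Real.mul_self_sqrt (by positivity)]
    nlinarith
  calc ((latticeBall N r).card : ℝ) = ∑ p ∈ latticeBall N r, (1 : ℝ) := by simp
    _ ≤ ∑ p ∈ latticeBall N r, Real.exp (l * r) ^ N * ∏ k, Real.exp (-(l * |(p k : ℝ)|)) :=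
        Finset.sum_le_sum h1
    _ ≤ ∑ p ∈ Fintype.piFinset fun _ : Fin N => s,
          Real.exp (l * r) ^ N * ∏ k, Real.exp (-(l * |(p k : ℝ)|)) :=
        Finset.sum_le_sum_of_subset_of_nonneg (Finset.filter_subset _ _)
          fun _ _ _ => by positivity
    _ = Real.exp (l * r) ^ N * (∑ j ∈ s, Real.exp (-(l * |(j : ℝ)|))) ^ N := by
        rw [← Finset.mul_sum, Finset.sum_prod_piFinset s (fun _ j => Real.exp (-(l * |(j : ℝ)|)))]
        simp
    _ ≤ Real.exp (l * r) ^ N * (1 + 2 / l) ^ N := by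
        gcongr
        exact sum_Icc_exp_neg_abs_le hl s
    _ = _ := by rw [mul_pow]

end Counting

/-! ### Independence of the rows. -/

/-- A product measure over pairs of indices is a product over the first index of products over the
second. -/
theorem iIndepFun.curry_prod {Ω ι κ : Type*} [Fintype ι] [Fintype κ] [MeasurableSpace Ω]
    {μ : Measure Ω} {f : ι × κ → Ω → ℝ} (hf : ∀ p, Measurable (f p)) (h : iIndepFun f μ) :
    iIndepFun (fun j ω i => f (j, i) ω) μ := by
  have := h.isProbabilityMeasure
  have hp : ∀ p, IsProbabilityMeasure (μ.map (f p)) := fun p =>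
    Measure.isProbabilityMeasure_map (hf p).aemeasurable
  have h' : iIndepFun (fun p : (_ : ι) × κ => f (p.1, p.2)) μ :=
    h.precomp (Equiv.sigmaEquivProd ι κ).injective
  have hrow : ∀ j, iIndepFun (fun i => f (j, i)) μ := fun j =>
    h.precomp (Prod.mk_right_injective j)
  rw [iIndepFun_iff_map_fun_eq_infinitePi_map (by fun_prop)] at h' ⊢
  have e : (fun ω j i => f (j, i) ω) =
      (MeasurableEquiv.piCurry fun (_ : ι) (_ : κ) => ℝ) ∘ (fun ω p => f (p.1, p.2) ω) := by
    ext; simp [Sigma.curry]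
  rw [e, ← Measure.map_map (by fun_prop) (by fun_prop), h',
    Measure.infinitePi_map_piCurry (fun i j ↦ μ.map (f (i, j)))]
  congr 1
  ext1 j
  exact ((iIndepFun_iff_map_fun_eq_infinitePi_map (fun i => hf (j, i))).1 (hrow j)).symm

section Rows

variable {Ω : Type*} [MeasurableSpace Ω] {μ : Measure Ω} {n N : ℕ}
  {B : ℝ} {Y : Fin n → Ω → EuclideanSpace ℝ (Fin N)}

theorem IsIIDSubgaussian.row
    (hY : IsIIDSubgaussian B (fun (p : Fin n × Fin N) (ω : Ω) => Y p.1 ω p.2) μ) (j : Fin n) :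
    IsIIDSubgaussian B (fun (i : Fin N) (ω : Ω) => Y j ω i) μ where
  measurable i := hY.measurable (j, i)
  indep := hY.indep.precomp (Prod.mk_right_injective j)
  identDistrib i i' := hY.identDistrib (j, i) (j, i')
  mean_zero i := hY.mean_zero (j, i)
  unit_variance i := hY.unit_variance (j, i)
  subgaussian i := hY.subgaussian (j, i)

theorem IsIIDSubgaussian.indep_rows
    (hY : IsIIDSubgaussian B (fun (p : Fin n × Fin N) (ω : Ω) => Y p.1 ω p.2) μ) :
    iIndepFun (fun j ω => Y j ω) μ := by
  have h := iIndepFun.curry_prod hY.measurable hY.indep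
  exact h.comp (fun _ x => WithLp.toLp 2 x) fun _ => (PiLp.continuous_toLp 2 _).measurable

/-- Exponential Markov inequality for sums over the independent rows. -/
theorem IsIIDSubgaussian.measure_rows_sum_ge_le
    (hY : IsIIDSubgaussian B (fun (p : Fin n × Fin N) (ω : Ω) => Y p.1 ω p.2) μ)
    {f : EuclideanSpace ℝ (Fin N) → ℝ} (hf : Measurable f) {M : ℝ} (hM : 0 ≤ M)
    (hint : ∀ j, Integrable (fun ω => Real.exp (f (Y j ω))) μ)
    (hle : ∀ j, ∫ ω, Real.exp (f (Y j ω)) ∂μ ≤ M) (a : ℝ) :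
    μ.real {ω | a ≤ ∑ j, f (Y j ω)} ≤ Real.exp (-a) * M ^ n := by
  have hm : ∀ j, Measurable (fun ω => ENNReal.ofReal (Real.exp (f (Y j ω)))) := fun j =>
    (Real.measurable_exp.comp (hf.comp (hY.row j).measurable_vec)).ennreal_ofReal
  have hind : iIndepFun (fun j ω => ENNReal.ofReal (Real.exp (f (Y j ω)))) μ :=
    hY.indep_rows.comp (fun _ y => ENNReal.ofReal (Real.exp (f y)))
      fun _ => (Real.measurable_exp.comp hf).ennreal_ofReal
  have h1 := lintegral_prod_eq_prod_lintegral_of_indepFun Finset.univ _ hind hm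
  have h2 : ∫⁻ ω, ∏ j, ENNReal.ofReal (Real.exp (f (Y j ω))) ∂μ ≤ ENNReal.ofReal (M ^ n) := by
    rw [h1]
    calc ∏ j, ∫⁻ ω, ENNReal.ofReal (Real.exp (f (Y j ω))) ∂μ ≤ ∏ _j : Fin n, ENNReal.ofReal M := by
          refine Finset.prod_le_prod' fun j _ => ?_
          rw [← ofReal_integral_eq_lintegral_ofReal (hint j)
            (Filter.Eventually.of_forall fun _ => (Real.exp_pos _).le)]
          exact ENNReal.ofReal_le_ofReal (hle j)
      _ = _ := by simp [ENNReal.ofReal_pow hM]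
  have h3 := mul_meas_ge_le_lintegral (μ := μ) (f := fun ω => ∏ j,
    ENNReal.ofReal (Real.exp (f (Y j ω)))) (Finset.measurable_prod _ fun j _ => hm j)
    (ENNReal.ofReal (Real.exp a))
  have h4 : {ω | a ≤ ∑ j, f (Y j ω)} ⊆
      {ω | ENNReal.ofReal (Real.exp a) ≤ ∏ j, ENNReal.ofReal (Real.exp (f (Y j ω)))} := by
    intro ω hω
    have hω' : a ≤ ∑ j, f (Y j ω) := hω
    show ENNReal.ofReal (Real.exp a) ≤ ∏ j, ENNReal.ofReal (Real.exp (f (Y j ω)))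
    rw [← ENNReal.ofReal_prod_of_nonneg fun _ _ => (Real.exp_pos _).le, ← Real.exp_sum]
    exact ENNReal.ofReal_le_ofReal (Real.exp_le_exp.2 hω')
  have h5 : ENNReal.ofReal (Real.exp a) * μ {ω | a ≤ ∑ j, f (Y j ω)} ≤ ENNReal.ofReal (M ^ n) :=
    (mul_le_mul_right (measure_mono h4) _).trans (h3.trans h2)
  have h6 : Real.exp a * μ.real {ω | a ≤ ∑ j, f (Y j ω)} ≤ M ^ n := by
    have h7 := ENNReal.toReal_mono ENNReal.ofReal_ne_top h5
    rwa [ENNReal.toReal_mul, ENNReal.toReal_ofReal (Real.exp_pos _).le,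
      ENNReal.toReal_ofReal (by positivity)] at h7
  calc μ.real {ω | a ≤ ∑ j, f (Y j ω)}
      = Real.exp (-a) * (Real.exp a * μ.real {ω | a ≤ ∑ j, f (Y j ω)}) := by
        rw [← mul_assoc, ← Real.exp_add]; simp
    _ ≤ _ := by gcongr

end Rows

/-! ### Linear forms in a subgaussian vector. -/

section InnerProduct

variable {Ω : Type*} [MeasurableSpace Ω] {μ : Measure Ω} {N : ℕ} {B : ℝ}
  {X : Ω → EuclideanSpace ℝ (Fin N)}

/-- The subgaussian moment of linear forms in subgaussian vectors. -/
noncomputable def formMoment (B : ℝ) : ℝ := 2 * (√11 * B)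

theorem formMoment_pos (hB : 0 < B) : 0 < formMoment B := by unfold formMoment; positivity

theorem IsIIDSubgaussian.subgaussianWith_inner [IsProbabilityMeasure μ] (hB : 0 < B)
    (hX : IsIIDSubgaussian B (fun (i : Fin N) (ω : Ω) => X ω i) μ)
    {x : EuclideanSpace ℝ (Fin N)} (hx : ‖x‖ = 1) :
    SubgaussianWith (formMoment B) (fun ω => inner ℝ (X ω) x) μ := by
  have h1 : ∀ i, HasSubgaussianMGF (fun ω => x i * X ω i)
      (Real.toNNReal (x i ^ 2) * Real.toNNReal (11 * B ^ 2)) μ := fun i => by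
    rw [Real.toNNReal_of_nonneg (sq_nonneg (x i))]
    exact ((hX.subgaussian i).hasSubgaussianMGF (hX.measurable i) (hX.mean_zero i)).const_mul (x i)
  have h2 : iIndepFun (fun i ω => x i * X ω i) μ :=
    hX.indep.comp (fun i t => x i * t) fun i => by fun_prop
  have h3 := HasSubgaussianMGF.sum_of_iIndepFun h2 (s := Finset.univ) fun i _ => h1 i
  have h4 : ∑ i, Real.toNNReal (x i ^ 2) * Real.toNNReal (11 * B ^ 2) =
      Real.toNNReal ((√11 * B) ^ 2) := by
    rw [← Finset.sum_mul, mul_pow, Real.sq_sqrt (by norm_num)]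
    have : ∑ i, Real.toNNReal (x i ^ 2) = 1 := by
      apply NNReal.coe_injective
      rw [NNReal.coe_sum]
      simp_rw [Real.coe_toNNReal _ (sq_nonneg _)]
      have := EuclideanSpace.real_norm_sq_eq x
      rw [hx] at this
      simpa using this.symm
    rw [this, one_mul]
  rw [h4] at h3
  have h5 : (fun ω => inner ℝ (X ω) x) = fun ω => ∑ i, x i * X ω i := by
    ext ω
    simp [PiLp.inner_apply]
  rw [h5]
  exact _root_.HasSubgaussianMGF.subgaussianWith (by positivity) h3

theorem IsIIDSubgaussian.integral_inner_sq [IsProbabilityMeasure μ]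
    (hX : IsIIDSubgaussian B (fun (i : Fin N) (ω : Ω) => X ω i) μ)
    {x : EuclideanSpace ℝ (Fin N)} (hx : ‖x‖ = 1) :
    ∫ ω, inner ℝ (X ω) x ^ 2 ∂μ = 1 := by
  have hL2 : ∀ i, MemLp (fun ω => x i * X ω i) 2 μ := fun i =>
    (((hX.subgaussian i).hasSubgaussianMGF (hX.measurable i) (hX.mean_zero i)).memLp 2).const_mul
      (x i)
  have h2 : iIndepFun (fun i ω => x i * X ω i) μ :=
    hX.indep.comp (fun i t => x i * t) fun i => by fun_prop
  have h3 := IndepFun.variance_sum (s := Finset.univ) (fun i _ => hL2 i)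
    fun i _ j _ hij => h2.indepFun hij
  have h5' : ∀ ω, inner ℝ (X ω) x = ∑ i, x i * X ω i := fun ω => by simp [PiLp.inner_apply]
  have h5 : (fun ω => inner ℝ (X ω) x) = ∑ i, fun ω => x i * X ω i := by
    ext ω
    rw [h5', Finset.sum_apply]
  have h6 : ∫ ω, inner ℝ (X ω) x ∂μ = 0 := by
    simp_rw [h5']
    rw [integral_finsetSum _ fun i _ => (hL2 i).integrable (by norm_num)]
    refine Finset.sum_eq_zero fun i _ => ?_
    rw [integral_const_mul, hX.mean_zero i, mul_zero]
  have hm : Measurable fun ω => inner ℝ (X ω) x := hX.measurable_vec.inner_const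
  have h7 := variance_eq_integral (μ := μ) hm.aemeasurable
  rw [h6] at h7
  simp only [sub_zero] at h7
  rw [← h7, h5, h3]
  simp_rw [variance_const_mul, hX.unit_variance, mul_one]
  have := EuclideanSpace.real_norm_sq_eq x
  rw [hx] at this
  simpa using this.symm

/-- From `e^{-u} ≤ 1 - u + u²/2` with `u = lZ²`: the choice `l = 1/(24b⁴)` makes the fourth moment
term at most `l/2`, half of the gain `l`. -/
theorem integral_exp_neg_sq_le [IsProbabilityMeasure μ] {Z : Ω → ℝ} (hZ : Measurable Z) {b : ℝ}
    (h : SubgaussianWith b Z μ) (h2 : ∫ ω, Z ω ^ 2 ∂μ = 1) :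
    ∫ ω, Real.exp (-(Z ω ^ 2 / (24 * b ^ 4))) ∂μ ≤ Real.exp (-(1 / (48 * b ^ 4))) := by
  obtain ⟨i4, h4⟩ := h.integrable_pow_four hZ
  have hb := h.1
  set l : ℝ := 1 / (24 * b ^ 4) with hl
  have hl0 : 0 < l := by positivity
  have i2 : Integrable (fun ω => Z ω ^ 2) μ := by
    by_contra hn
    rw [integral_undef hn] at h2
    norm_num at h2
  have hpt : ∀ ω, Real.exp (-(Z ω ^ 2 / (24 * b ^ 4))) ≤
      1 - l * Z ω ^ 2 + l ^ 2 / 2 * Z ω ^ 4 := by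
    intro ω
    have e : Z ω ^ 2 / (24 * b ^ 4) = l * Z ω ^ 2 := by rw [hl]; ring
    rw [e]
    set u := l * Z ω ^ 2
    have hu : 0 ≤ u := by positivity
    have e2 : l ^ 2 / 2 * Z ω ^ 4 = u ^ 2 / 2 := by simp only [u]; ring
    rw [e2]
    have h1 := Real.quadratic_le_exp_of_nonneg hu
    have h3 : 1 ≤ (1 - u + u ^ 2 / 2) * (1 + u + u ^ 2 / 2) := by nlinarith [sq_nonneg (u ^ 2)]
    have h5 : 0 < 1 - u + u ^ 2 / 2 := by nlinarith [sq_nonneg (u - 1)]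
    rw [Real.exp_neg, inv_le_iff_one_le_mul₀ (Real.exp_pos _)]
    exact h3.trans (by gcongr)
  have i1 : Integrable (fun ω => 1 - l * Z ω ^ 2) μ := (integrable_const _).sub (i2.const_mul l)
  calc ∫ ω, Real.exp (-(Z ω ^ 2 / (24 * b ^ 4))) ∂μ
      ≤ ∫ ω, (1 - l * Z ω ^ 2 + l ^ 2 / 2 * Z ω ^ 4) ∂μ := by
        refine integral_mono ?_ (i1.add (i4.const_mul _)) hpt
        refine (integrable_const (1 : ℝ)).mono' (by fun_prop)
          (Filter.Eventually.of_forall fun ω => ?_)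
        rw [Real.norm_of_nonneg (Real.exp_pos _).le]
        exact Real.exp_le_one_iff.2 (neg_nonpos.2 (by positivity))
    _ = 1 - l + l ^ 2 / 2 * ∫ ω, Z ω ^ 4 ∂μ := by
        rw [integral_add i1 (i4.const_mul _), integral_sub (integrable_const _) (i2.const_mul l),
          integral_const_mul, integral_const_mul, h2]
        simp
    _ ≤ 1 - l + l ^ 2 / 2 * (24 * b ^ 4) := by gcongr
    _ = 1 - 1 / (48 * b ^ 4) := by rw [hl]; field_simp; ring
    _ ≤ _ := by
        have := Real.add_one_le_exp (-(1 / (48 * b ^ 4)))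
        linarith

end InnerProduct

/-! ### The random matrix on fixed vectors, and its operator norm. -/

section RandomMatrix

variable {n N : ℕ}

/-- The linear map `x ↦ (⟨y j, x⟩)_j` given by the matrix with rows `y j`. -/
noncomputable def rowMap (y : Fin n → EuclideanSpace ℝ (Fin N)) :
    EuclideanSpace ℝ (Fin N) →L[ℝ] EuclideanSpace ℝ (Fin n) :=
  LinearMap.toContinuousLinearMap
    ((WithLp.linearEquiv 2 ℝ (Fin n → ℝ)).symm.toLinearMap ∘ₗ
      LinearMap.pi fun j => (innerSL ℝ (y j)).toLinearMap)

theorem rowMap_apply (y : Fin n → EuclideanSpace ℝ (Fin N)) (x : EuclideanSpace ℝ (Fin N))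
    (j : Fin n) : rowMap y x j = inner ℝ (y j) x := rfl

theorem norm_rowMap_sq (y : Fin n → EuclideanSpace ℝ (Fin N)) (x : EuclideanSpace ℝ (Fin N)) :
    ‖rowMap y x‖ ^ 2 = ∑ j, inner ℝ (y j) x ^ 2 := by
  rw [EuclideanSpace.real_norm_sq_eq]
  simp_rw [rowMap_apply]

theorem norm_rowMap_eq (y : Fin n → EuclideanSpace ℝ (Fin N)) {x : EuclideanSpace ℝ (Fin N)}
    (hx : x ≠ 0) : ‖rowMap y x‖ ^ 2 = ‖x‖ ^ 2 * ∑ j, inner ℝ (y j) (‖x‖⁻¹ • x) ^ 2 := by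
  have h : ‖x‖ ≠ 0 := norm_ne_zero_iff.2 hx
  rw [← norm_rowMap_sq, map_smul, norm_smul, norm_inv, norm_norm]
  field_simp

theorem norm_inv_norm_smul {x : EuclideanSpace ℝ (Fin N)} (hx : x ≠ 0) : ‖‖x‖⁻¹ • x‖ = 1 := by
  rw [norm_smul, norm_inv, norm_norm, inv_mul_cancel₀ (norm_ne_zero_iff.2 hx)]

variable {Ω : Type*} [MeasurableSpace Ω] {μ : Measure Ω} [IsProbabilityMeasure μ]
  {B : ℝ} {Y : Fin n → Ω → EuclideanSpace ℝ (Fin N)}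

theorem IsIIDSubgaussian.measure_norm_rowMap_ge_le (hB : 0 < B)
    (hY : IsIIDSubgaussian B (fun (p : Fin n × Fin N) (ω : Ω) => Y p.1 ω p.2) μ)
    {x : EuclideanSpace ℝ (Fin N)} (hx : x ≠ 0) (a : ℝ) :
    μ.real {ω | a * ‖x‖ ^ 2 ≤ ‖rowMap (fun j => Y j ω) x‖ ^ 2} ≤
      Real.exp (-(a / (2 * formMoment B ^ 2))) * 3 ^ n := by
  have hx1 := norm_inv_norm_smul hx
  set u := ‖x‖⁻¹ • x
  have hb := formMoment_pos hB
  have hs : ∀ j, _ := fun j => ((hY.row j).subgaussianWith_inner hB hx1).integral_exp_sq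
    ((hY.row j).measurable_vec.inner_const)
  have h := hY.measure_rows_sum_ge_le (f := fun y => inner ℝ y u ^ 2 / (2 * formMoment B ^ 2))
    (by fun_prop) (M := 3) (by norm_num) (fun j => (hs j).1) (fun j => (hs j).2)
    (a / (2 * formMoment B ^ 2))
  refine le_trans (measureReal_mono fun ω hω => ?_) h
  have hω' : a * ‖x‖ ^ 2 ≤ ‖rowMap (fun j => Y j ω) x‖ ^ 2 := hω
  show a / (2 * formMoment B ^ 2) ≤ ∑ j, inner ℝ (Y j ω) u ^ 2 / (2 * formMoment B ^ 2)
  rw [← Finset.sum_div]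
  gcongr
  rw [norm_rowMap_eq _ hx, mul_comm] at hω'
  exact le_of_mul_le_mul_left hω' (by have := norm_pos_iff.2 hx; positivity)

/-- The threshold `n/4` spends half of the exponent `n/(48b⁴)` gained by the independent rows. -/
theorem IsIIDSubgaussian.measure_norm_rowMap_le_le (hB : 0 < B)
    (hY : IsIIDSubgaussian B (fun (p : Fin n × Fin N) (ω : Ω) => Y p.1 ω p.2) μ)
    {x : EuclideanSpace ℝ (Fin N)} (hx : x ≠ 0) :
    μ.real {ω | ‖rowMap (fun j => Y j ω) x‖ ^ 2 ≤ n / 4 * ‖x‖ ^ 2} ≤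
      Real.exp (-(n / (96 * formMoment B ^ 4))) := by
  have hx1 := norm_inv_norm_smul hx
  set u := ‖x‖⁻¹ • x
  have hb := formMoment_pos hB
  have hm : ∀ j, Measurable fun ω => inner ℝ (Y j ω) u := fun j =>
    (hY.row j).measurable_vec.inner_const
  have hs : ∀ j, _ := fun j => integral_exp_neg_sq_le (hm j)
    ((hY.row j).subgaussianWith_inner hB hx1) ((hY.row j).integral_inner_sq hx1)
  have h := hY.measure_rows_sum_ge_le
    (f := fun y => -(inner ℝ y u ^ 2 / (24 * formMoment B ^ 4)))
    (by fun_prop) (M := Real.exp (-(1 / (48 * formMoment B ^ 4)))) (Real.exp_pos _).le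
    (fun j => ?_) hs (-(n / 4 / (24 * formMoment B ^ 4)))
  · refine le_trans (measureReal_mono fun ω hω => ?_) (h.trans_eq ?_)
    · have hω' : ‖rowMap (fun j => Y j ω) x‖ ^ 2 ≤ n / 4 * ‖x‖ ^ 2 := hω
      show -(n / 4 / (24 * formMoment B ^ 4)) ≤
        ∑ j, -(inner ℝ (Y j ω) u ^ 2 / (24 * formMoment B ^ 4))
      rw [Finset.sum_neg_distrib, ← Finset.sum_div, neg_le_neg_iff]
      gcongr
      rw [norm_rowMap_eq _ hx, mul_comm] at hω'
      exact le_of_mul_le_mul_right hω' (by have := norm_pos_iff.2 hx; positivity)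
    · rw [← Real.exp_nat_mul, ← Real.exp_add]
      congr 1
      field_simp
      ring
  · refine (integrable_const (1 : ℝ)).mono'
      ((((hm j).pow_const 2).div_const _).neg.exp).aestronglyMeasurable
      (Filter.Eventually.of_forall fun ω => ?_)
    rw [Real.norm_of_nonneg (Real.exp_pos _).le]
    exact Real.exp_le_one_iff.2 (neg_nonpos.2 (by positivity))

/-- The isometric embedding of the line in the direction of a unit vector. -/
noncomputable def lineIsometry (u : EuclideanSpace ℝ (Fin N)) (hu : ‖u‖ = 1) :
    EuclideanSpace ℝ (Fin 1) →ₗᵢ[ℝ] EuclideanSpace ℝ (Fin N) where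
  toFun y := y 0 • u
  map_add' y z := by simp [add_smul]
  map_smul' c y := by simp [mul_smul]
  norm_map' y := by
    change ‖y 0 • u‖ = ‖y‖
    rw [norm_smul, hu, mul_one, EuclideanSpace.norm_eq]
    simp [Real.sqrt_sq_eq_abs]

theorem norm_adjoint_lineIsometry (u : EuclideanSpace ℝ (Fin N)) (hu : ‖u‖ = 1)
    (x : EuclideanSpace ℝ (Fin N)) :
    ‖(lineIsometry u hu).toContinuousLinearMap.adjoint x‖ ^ 2 = inner ℝ x u ^ 2 := by
  rw [EuclideanSpace.real_norm_sq_eq]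
  simp only [Fin.sum_univ_one]
  have h := ContinuousLinearMap.adjoint_inner_left
    ((lineIsometry u hu).toContinuousLinearMap) (EuclideanSpace.single 0 1) x
  have h2 : (lineIsometry u hu).toContinuousLinearMap (EuclideanSpace.single 0 1) = u := by
    change (EuclideanSpace.single (0 : Fin 1) (1 : ℝ)) 0 • u = u
    simp
  rw [h2, EuclideanSpace.inner_single_right] at h
  simp only [one_mul, conj_trivial] at h
  rw [h]

/-- The small ball estimate in dimension one, for the line through `x`, is applied to each row, and
independence raises it to the power `n`. The constant `e` collects `e^{1/2}` from the estimate and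
`e^{1/2}` from Markov. -/
theorem IsIIDSubgaussian.measure_norm_rowMap_le_of_not_nearLattice (hB : 0 < B)
    (hY : IsIIDSubgaussian B (fun (p : Fin n × Fin N) (ω : Ω) => Y p.1 ω p.2) μ)
    {x : EuclideanSpace ℝ (Fin N)} (hx : x ≠ 0) {γ α D ε : ℝ} (hγ : 0 < γ) (hα : 0 ≤ α)
    (hε : 0 < ε) (hD : 1 ≤ ε * D)
    (hxD : ∀ t : ℝ, |t| * ‖x‖ < D → ¬ NearLattice γ α (t • x)) :
    μ.real {ω | ‖rowMap (fun j => Y j ω) x‖ ^ 2 ≤ n * ε ^ 2 * ‖x‖ ^ 2} ≤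
      (Real.exp 1 * (ballConst γ (symMass B) * ε + Real.exp (-(symMass B * α ^ 2)))) ^ n := by
  have hx0 := norm_pos_iff.2 hx
  have hx1 := norm_inv_norm_smul hx
  set u := ‖x‖⁻¹ • x with hu
  have hm : ∀ j, Measurable fun ω => inner ℝ (Y j ω) u := fun j =>
    (hY.row j).measurable_vec.inner_const
  have hs : ∀ j, ∫ ω, Real.exp (-(inner ℝ (Y j ω) u ^ 2 / (2 * ε ^ 2))) ∂μ ≤
      Real.exp (1 / 2) * (ballConst γ (symMass B) * ε + Real.exp (-(symMass B * α ^ 2))) := by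
    intro j
    have h := (hY.row j).small_ball one_pos hB (lineIsometry u hx1) hγ hα hε (D := D)
      (fun y hy => ?_) (by simpa using hD) 0
    · simp only [sub_zero, neg_div, norm_adjoint_lineIsometry, Nat.cast_one, pow_one] at h
      exact h
    · change ¬ NearLattice γ α (y 0 • u)
      have hyn : ‖y‖ = |y 0| := by
        have := (lineIsometry u hx1).norm_map y
        change ‖y 0 • u‖ = ‖y‖ at this
        rw [norm_smul, hx1, mul_one] at this
        exact this.symm
      rw [hu, smul_smul]
      apply hxD
      rw [abs_mul, abs_inv, abs_norm, mul_assoc, inv_mul_cancel₀ hx0.ne', mul_one, ← hyn]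
      exact hy
  have hM : 0 ≤ Real.exp (1 / 2) *
      (ballConst γ (symMass B) * ε + Real.exp (-(symMass B * α ^ 2))) := by
    have : 0 ≤ ballConst γ (symMass B) := Real.sqrt_nonneg _
    positivity
  have h := hY.measure_rows_sum_ge_le (f := fun y => -(inner ℝ y u ^ 2 / (2 * ε ^ 2)))
    (by fun_prop) hM (fun j => ?_) hs (-(n / 2 : ℝ))
  · refine le_trans (measureReal_mono fun ω hω => ?_) (h.trans_eq ?_)
    · have hω' : ‖rowMap (fun j => Y j ω) x‖ ^ 2 ≤ n * ε ^ 2 * ‖x‖ ^ 2 := hω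
      show -(n / 2 : ℝ) ≤ ∑ j, -(inner ℝ (Y j ω) u ^ 2 / (2 * ε ^ 2))
      rw [Finset.sum_neg_distrib, ← Finset.sum_div, neg_le_neg_iff, div_le_iff₀ (by positivity)]
      rw [norm_rowMap_eq _ hx, mul_comm] at hω'
      have := le_of_mul_le_mul_right hω' (by positivity)
      linarith
    · rw [neg_neg]
      have e : Real.exp ((n : ℝ) / 2) = Real.exp (1 / 2) ^ n := by
        rw [← Real.exp_nat_mul]; congr 1; ring
      rw [e, ← mul_pow, ← mul_assoc, ← Real.exp_add]
      norm_num
  · refine (integrable_const (1 : ℝ)).mono'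
      ((((hm j).pow_const 2).div_const _).neg.exp).aestronglyMeasurable
      (Filter.Eventually.of_forall fun ω => ?_)
    rw [Real.norm_of_nonneg (Real.exp_pos _).le]
    exact Real.exp_le_one_iff.2 (neg_nonpos.2 (by positivity))

theorem measureReal_le_card_mul {ι : Type*} {S : Set Ω} {F : Finset ι} {T : ι → Set Ω} {δ : ℝ}
    (hS : S ⊆ ⋃ i ∈ F, T i) (hT : ∀ i ∈ F, μ.real (T i) ≤ δ) : μ.real S ≤ F.card * δ := by
  calc μ.real S ≤ μ.real (⋃ i ∈ F, T i) := measureReal_mono hS (measure_ne_top _ _)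
    _ ≤ ∑ i ∈ F, μ.real (T i) := measureReal_biUnion_finset_le _ _
    _ ≤ ∑ _i ∈ F, δ := Finset.sum_le_sum hT
    _ = _ := by simp

/-- Vectors are approximated by lattice vectors up to `√N / 2`. -/
theorem norm_sub_latticeVec_round_le (x : EuclideanSpace ℝ (Fin N)) :
    ‖x - latticeVec (fun k => round (x k))‖ ≤ √(N : ℝ) / 2 := by
  refine le_of_sq_le_sq ?_ (by positivity)
  rw [div_pow, Real.sq_sqrt (by positivity), EuclideanSpace.real_norm_sq_eq]
  calc ∑ k, (x - latticeVec fun k => round (x k)) k ^ 2 ≤ ∑ _k : Fin N, (1 / 4 : ℝ) := by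
        refine Finset.sum_le_sum fun k _ => ?_
        have := abs_sub_round (x k)
        have h : (x - latticeVec fun k => round (x k)) k = x k - round (x k) := rfl
        rw [h, ← sq_abs]
        nlinarith [abs_nonneg (x k - round (x k))]
    _ = _ := by simp; ring

/-- The operator norm of a random matrix is `O(√N)` up to an exponentially small probability. -/
theorem IsIIDSubgaussian.measure_opNorm_le (hB : 0 < B) (hnN : n ≤ N) (hN : 0 < N)
    (hY : IsIIDSubgaussian B (fun (p : Fin n × Fin N) (ω : Ω) => Y p.1 ω p.2) μ) :
    μ.real {ω | 12 * formMoment B * √(N : ℝ) < ‖rowMap (fun j => Y j ω)‖} ≤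
      Real.exp (-(N : ℝ)) := by
  classical
  have hb := formMoment_pos hB
  set b := formMoment B
  have hNr : (0 : ℝ) < N := by exact_mod_cast hN
  have hsN : 0 < √(N : ℝ) := Real.sqrt_pos.2 hNr
  have hsub : {ω | 12 * b * √(N : ℝ) < ‖rowMap (fun j => Y j ω)‖} ⊆
      ⋃ p ∈ (latticeBall N 2).filter (fun p => latticeVec p ≠ 0),
        {ω | 16 * b ^ 2 * N * ‖latticeVec p‖ ^ 2 ≤ ‖rowMap (fun j => Y j ω) (latticeVec p)‖ ^ 2} := by
    intro ω hω
    by_contra hcon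
    simp only [Set.mem_iUnion, not_exists, Finset.mem_filter] at hcon
    set L := rowMap (fun j => Y j ω) with hL
    have hω' : 12 * b * √(N : ℝ) < ‖L‖ := hω
    have hp : ∀ p ∈ latticeBall N 2, ‖L (latticeVec p)‖ ≤ 4 * b * √(N : ℝ) * ‖latticeVec p‖ := by
      intro p hp
      by_cases h0 : latticeVec p = 0
      · simp [h0]
      · have h1 : ¬ (16 * b ^ 2 * N * ‖latticeVec p‖ ^ 2 ≤ ‖L (latticeVec p)‖ ^ 2) :=
          hcon p ⟨hp, h0⟩
        refine le_of_sq_le_sq ?_ (by positivity)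
        rw [mul_pow, mul_pow, mul_pow, Real.sq_sqrt hNr.le]
        linarith
    -- Rounding `√N x` gives a lattice point within `√N/2`, so the rescaled lattice is a 1/2-net of
    -- the sphere. The error `‖L‖/2` is absorbed on the left, doubling `6b√N`.
    have hunit : ∀ x : EuclideanSpace ℝ (Fin N), ‖x‖ = 1 →
        ‖L x‖ ≤ 6 * b * √(N : ℝ) + ‖L‖ / 2 := by
      intro x hx
      set p : Fin N → ℤ := fun k => round ((√(N : ℝ) • x) k)
      have h1 : ‖√(N : ℝ) • x - latticeVec p‖ ≤ √(N : ℝ) / 2 := norm_sub_latticeVec_round_le _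
      have h2 : ‖√(N : ℝ) • x‖ = √(N : ℝ) := by
        rw [norm_smul, hx, mul_one, Real.norm_of_nonneg hsN.le]
      have h3 : ‖latticeVec p‖ ≤ 3 / 2 * √(N : ℝ) := by
        have := norm_sub_norm_le (latticeVec p) (√(N : ℝ) • x)
        rw [norm_sub_rev] at this
        linarith
      have h4 := hp p (mem_latticeBall.2 (by linarith))
      have h5 : ‖L (√(N : ℝ) • x)‖ ≤ ‖L (latticeVec p)‖ + ‖L‖ * (√(N : ℝ) / 2) := by
        have e : L (√(N : ℝ) • x) = L (latticeVec p) + L (√(N : ℝ) • x - latticeVec p) := by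
          rw [← map_add]; congr 1; abel
        rw [e]
        refine (norm_add_le _ _).trans ?_
        gcongr
        exact (L.le_opNorm _).trans (by gcongr)
      rw [map_smul, norm_smul, Real.norm_of_nonneg hsN.le] at h5
      have h6 : 4 * b * √(N : ℝ) * ‖latticeVec p‖ ≤ 4 * b * √(N : ℝ) * (3 / 2 * √(N : ℝ)) := by
        gcongr
      refine le_of_mul_le_mul_left ?_ hsN
      nlinarith
    have h7 := ContinuousLinearMap.opNorm_le_of_unit_norm (f := L)
      (C := 6 * b * √(N : ℝ) + ‖L‖ / 2) (by positivity) hunit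
    linarith
  have hbound := measureReal_le_card_mul (μ := μ) hsub (δ := Real.exp (-(8 * N : ℝ)) * 3 ^ N)
    fun p hp => by
      rw [Finset.mem_filter] at hp
      refine (hY.measure_norm_rowMap_ge_le hB hp.2 (16 * b ^ 2 * N)).trans ?_
      have e : 16 * b ^ 2 * N / (2 * formMoment B ^ 2) = 8 * (N : ℝ) := by
        change 16 * b ^ 2 * N / (2 * b ^ 2) = _
        field_simp
        norm_num
      rw [e]
      gcongr
      norm_num
  have hcard : (((latticeBall N 2).filter (fun p => latticeVec p ≠ 0)).card : ℝ) ≤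
      (Real.exp 1 * 5) ^ N := by
    have h1 := card_latticeBall_le (N := N) 2 (l := 1 / 2) (by norm_num)
    norm_num at h1
    refine le_trans ?_ (by simpa using h1)
    exact_mod_cast Finset.card_filter_le _ _
  refine hbound.trans ?_
  calc _ ≤ (Real.exp 1 * 5) ^ N * (Real.exp (-(8 * N : ℝ)) * 3 ^ N) := by gcongr
    _ = (Real.exp 1 * 5 * Real.exp (-8) * 3) ^ N := by
      have : Real.exp (-(8 * N : ℝ)) = Real.exp (-8) ^ N := by
        rw [← Real.exp_nat_mul]; congr 1; ring
      rw [this, mul_pow, mul_pow, mul_pow, mul_pow]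
      ring
    _ ≤ (Real.exp (-1)) ^ N := by
      gcongr
      have h1 : Real.exp 1 * 5 * Real.exp (-8) * 3 = 15 * Real.exp (-7) := by
        have : Real.exp (-7) = Real.exp 1 * Real.exp (-8) := by rw [← Real.exp_add]; norm_num
        rw [this]; ring
      have h2 : Real.exp (-1) = Real.exp 6 * Real.exp (-7) := by rw [← Real.exp_add]; norm_num
      have h3 : (15 : ℝ) ≤ Real.exp 6 := by
        have h4 := Real.add_one_le_exp (3 : ℝ)
        have : Real.exp 6 = Real.exp 3 * Real.exp 3 := by rw [← Real.exp_add]; norm_num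
        nlinarith
      rw [h1, h2]
      gcongr
    _ = _ := by rw [← Real.exp_nat_mul]; congr 1; ring

end RandomMatrix

/-! ### Kernel vectors near the integer lattice. -/

section Kernel

variable {n N : ℕ} {Ω : Type*} [MeasurableSpace Ω] {μ : Measure Ω} [IsProbabilityMeasure μ]
  {B : ℝ} {Y : Fin n → Ω → EuclideanSpace ℝ (Fin N)}

/-- Kernel vectors of small norm are far from the integer lattice in the relative sense. -/
theorem IsIIDSubgaussian.measure_kernel_small_le (hB : 0 < B) (hnN : (N : ℝ) ≤ 2 * n)
    (hY : IsIIDSubgaussian B (fun (p : Fin n × Fin N) (ω : Ω) => Y p.1 ω p.2) μ)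
    {K γ η : ℝ} (hK : 0 ≤ K) (hγ0 : 0 ≤ γ) (hγ : γ ≤ 1 / 2) (hKγ : 32 * K ^ 2 * γ ^ 2 ≤ 1)
    (hη : η = 1 / (96 * formMoment B ^ 4)) :
    μ.real {ω | ‖rowMap (fun j => Y j ω)‖ ≤ K * √(N : ℝ) ∧ ∃ x, rowMap (fun j => Y j ω) x = 0 ∧
      ‖x‖ < η ^ 2 / 256 * √(N : ℝ) ∧ ∃ p, ‖x - latticeVec p‖ < γ * ‖x‖} ≤
      Real.exp (-(η / 4 * N)) := by
  classical
  have hb := formMoment_pos hB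
  have hη0 : 0 < η := by rw [hη]; positivity
  have hsub : {ω | ‖rowMap (fun j => Y j ω)‖ ≤ K * √(N : ℝ) ∧
      ∃ x, rowMap (fun j => Y j ω) x = 0 ∧
      ‖x‖ < η ^ 2 / 256 * √(N : ℝ) ∧ ∃ p, ‖x - latticeVec p‖ < γ * ‖x‖} ⊆
      ⋃ p ∈ (latticeBall N (η ^ 2 / 128)).filter (fun p => latticeVec p ≠ 0),
        {ω | ‖rowMap (fun j => Y j ω) (latticeVec p)‖ ^ 2 ≤ n / 4 * ‖latticeVec p‖ ^ 2} := by
    rintro ω ⟨hL, x, hx0, hx, p, hp⟩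
    set L := rowMap (fun j => Y j ω) with hLdef
    simp only [Set.mem_iUnion, Finset.mem_filter]
    have hxp : 0 < ‖x‖ := by
      rcases (norm_nonneg x).eq_or_lt with h | h
      · rw [← h, mul_zero] at hp
        exact absurd hp (not_lt.2 (norm_nonneg _))
      · exact h
    have h1 : ‖x - latticeVec p‖ ≤ ‖x‖ / 2 := by nlinarith
    have h2 : ‖x‖ / 2 ≤ ‖latticeVec p‖ := by
      have := norm_sub_norm_le x (latticeVec p); linarith
    have h3 : ‖latticeVec p‖ ≤ 2 * ‖x‖ := by
      have := norm_sub_norm_le (latticeVec p) x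
      rw [norm_sub_rev] at this; linarith
    refine ⟨p, ⟨mem_latticeBall.2 (by linarith), fun h => ?_⟩, ?_⟩
    · rw [h, norm_zero] at h2; linarith
    · show ‖L (latticeVec p)‖ ^ 2 ≤ n / 4 * ‖latticeVec p‖ ^ 2
      -- Since `L x = 0`, the vector `L p` is the image of the approximation error; a small `Kγ`
      -- makes it shorter than a typical image of `p`.
      have h4 : ‖L (latticeVec p)‖ ≤ K * √(N : ℝ) * (2 * γ * ‖latticeVec p‖) := by
        have e : L (latticeVec p) = -L (x - latticeVec p) := by rw [map_sub, hx0]; simp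
        rw [e, norm_neg]
        refine (L.le_opNorm _).trans ?_
        gcongr
        nlinarith
      calc ‖L (latticeVec p)‖ ^ 2 ≤ (K * √(N : ℝ) * (2 * γ * ‖latticeVec p‖)) ^ 2 := by gcongr
        _ = 4 * (K ^ 2 * γ ^ 2) * N * ‖latticeVec p‖ ^ 2 := by
          rw [mul_pow, mul_pow, Real.sq_sqrt (by positivity)]; ring
        _ ≤ n / 4 * ‖latticeVec p‖ ^ 2 := by
          gcongr
          have : K ^ 2 * γ ^ 2 ≤ 1 / 32 := by linarith
          nlinarith
  have hbound := measureReal_le_card_mul (μ := μ) hsub (δ := Real.exp (-(η / 2 * N)))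
    fun p hp => by
      rw [Finset.mem_filter] at hp
      refine (hY.measure_norm_rowMap_le_le hB hp.2).trans (Real.exp_le_exp.2 ?_)
      have : (n : ℝ) / (96 * formMoment B ^ 4) = η * n := by rw [hη]; ring
      rw [this]
      nlinarith
  have hcard : (((latticeBall N (η ^ 2 / 128)).filter (fun p => latticeVec p ≠ 0)).card : ℝ) ≤
      Real.exp (η / 4 * N) := by
    refine le_trans (Nat.cast_le.2 (Finset.card_filter_le _ _)) ?_
    -- With `l = 16/η` both `l·η²/128` and `2/l` equal `η/8`, so the count `e^{ηN/4}` is beaten by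
    -- the probability `e^{-ηN/2}`.
    refine (card_latticeBall_le (N := N) (η ^ 2 / 128) (l := 16 / η) (by positivity)).trans ?_
    have h1 : Real.exp (16 / η * (η ^ 2 / 128)) * (1 + 2 / (16 / η)) ≤ Real.exp (η / 4) := by
      have h2 : 1 + 2 / (16 / η) ≤ Real.exp (η / 8) := by
        have := Real.add_one_le_exp (η / 8)
        have e : 2 / (16 / η) = η / 8 := by field_simp; norm_num
        rw [e]; linarith
      calc _ ≤ Real.exp (16 / η * (η ^ 2 / 128)) * Real.exp (η / 8) := by gcongr
        _ = _ := by rw [← Real.exp_add]; congr 1; field_simp; norm_num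
    calc _ ≤ Real.exp (η / 4) ^ N := by gcongr
      _ = _ := by rw [← Real.exp_nat_mul]; congr 1; ring
  calc _ ≤ Real.exp (η / 4 * N) * Real.exp (-(η / 2 * N)) := hbound.trans (by gcongr)
    _ = _ := by rw [← Real.exp_add]; congr 1; ring

/-- The kernel rarely contains a vector of norm about `y √N` near the lattice none of whose
shorter multiples is near the lattice. -/
theorem IsIIDSubgaussian.measure_kernel_level_le (hB : 0 < B) (hnN : (N : ℝ) ≤ 2 * n)
    (hY : IsIIDSubgaussian B (fun (p : Fin n × Fin N) (ω : Ω) => Y p.1 ω p.2) μ)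
    {K γ a y c : ℝ} (hK : 0 < K) (hγ : 0 < γ) (ha : 0 < a) (hc : 0 < c) (hcy : c ≤ y) (hay : a ≤ y)
    (hN1 : 1 ≤ 4 * K * a * √(N : ℝ))
    (hN2 : Real.exp (-(symMass B * (a * √(N : ℝ)) ^ 2)) ≤ 4 * K * a / y) :
    μ.real {ω | ‖rowMap (fun j => Y j ω)‖ ≤ K * √(N : ℝ) ∧ ∃ x, rowMap (fun j => Y j ω) x = 0 ∧
      (y * √(N : ℝ) ≤ ‖x‖ ∧ ‖x‖ < 2 * (y * √(N : ℝ)) ∧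
        ∀ t : ℝ, |t| * ‖x‖ < y * √(N : ℝ) → ¬ NearLattice γ (a * √(N : ℝ)) (t • x)) ∧
      ∃ p, ‖x - latticeVec p‖ < a * √(N : ℝ)} ≤
      (Real.exp 1 * (1 / c + 6) * y) ^ N *
        (4 * Real.exp 1 * (ballConst γ (symMass B) + 1) * K * a / y) ^ n := by
  classical
  have hy : 0 < y := hc.trans_le hcy
  have hsN : 0 < √(N : ℝ) := by
    by_contra h
    have : √(N : ℝ) = 0 := le_antisymm (not_lt.1 h) (Real.sqrt_nonneg _)
    rw [this, mul_zero] at hN1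
    linarith
  set ε := 4 * K * a / y with hε
  have hε0 : 0 < ε := by positivity
  have hC0 : 0 ≤ ballConst γ (symMass B) := Real.sqrt_nonneg _
  set good : EuclideanSpace ℝ (Fin N) → Prop := fun x => y * √(N : ℝ) ≤ ‖x‖ ∧
    ‖x‖ < 2 * (y * √(N : ℝ)) ∧
    ∀ t : ℝ, |t| * ‖x‖ < y * √(N : ℝ) → ¬ NearLattice γ (a * √(N : ℝ)) (t • x) with hgood
  -- The kernel vector is random, but the single-vector estimate needs a fixed one. Each lattice
  -- point therefore gets a deterministic representative `z p` with the same properties whenever one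
  -- exists.
  have hch : ∀ p : Fin N → ℤ, ∃ x : EuclideanSpace ℝ (Fin N), good x ∧
      ‖x - latticeVec p‖ < a * √(N : ℝ) ∨ ¬ ∃ x, good x ∧ ‖x - latticeVec p‖ < a * √(N : ℝ) := by
    intro p
    by_cases h : ∃ x, good x ∧ ‖x - latticeVec p‖ < a * √(N : ℝ)
    · obtain ⟨x, hx⟩ := h
      exact ⟨x, Or.inl hx⟩
    · exact ⟨0, Or.inr h⟩
  choose z hz using hch
  set F := (latticeBall N (3 * y)).filter fun p => good (z p) with hF
  have hsub : {ω | ‖rowMap (fun j => Y j ω)‖ ≤ K * √(N : ℝ) ∧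
      ∃ x, rowMap (fun j => Y j ω) x = 0 ∧ good x ∧ ∃ p, ‖x - latticeVec p‖ < a * √(N : ℝ)} ⊆
      ⋃ p ∈ F, {ω | ‖rowMap (fun j => Y j ω) (z p)‖ ^ 2 ≤ n * ε ^ 2 * ‖z p‖ ^ 2} := by
    rintro ω ⟨hL, x, hx0, hx, p, hp⟩
    set L := rowMap (fun j => Y j ω) with hLdef
    have hzp := (hz p).resolve_right (not_not.2 ⟨x, hx, hp⟩)
    simp only [Set.mem_iUnion]
    refine ⟨p, Finset.mem_filter.2 ⟨mem_latticeBall.2 ?_, hzp.1⟩, ?_⟩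
    · have h1 := norm_sub_norm_le (latticeVec p) x
      rw [norm_sub_rev] at h1
      have := hx.2.1
      have : a * √(N : ℝ) ≤ y * √(N : ℝ) := by gcongr
      linarith
    · show ‖L (z p)‖ ^ 2 ≤ n * ε ^ 2 * ‖z p‖ ^ 2
      -- Both `z p` and the kernel vector `x` are within `a√N` of `p`, and `L` sees only their
      -- difference.
      have h1 : ‖L (z p)‖ ≤ K * √(N : ℝ) * (2 * (a * √(N : ℝ))) := by
        have e : L (z p) = L (z p - x) := by rw [map_sub, hx0, sub_zero]
        rw [e]
        refine (L.le_opNorm _).trans ?_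
        gcongr
        have e2 : z p - x = (z p - latticeVec p) - (x - latticeVec p) := by abel
        rw [e2]
        refine (norm_sub_le _ _).trans ?_
        linarith [hzp.2]
      have h2 : y * √(N : ℝ) ≤ ‖z p‖ := hzp.1.1
      have hsq : √(N : ℝ) ^ 2 = N := Real.sq_sqrt (by positivity)
      calc ‖L (z p)‖ ^ 2 ≤ (K * √(N : ℝ) * (2 * (a * √(N : ℝ)))) ^ 2 := by gcongr
        _ = 4 * K ^ 2 * a ^ 2 * N * √(N : ℝ) ^ 2 := by
          rw [mul_pow, mul_pow, mul_pow, mul_pow, hsq]; ring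
        _ ≤ 4 * K ^ 2 * a ^ 2 * (4 * n) * √(N : ℝ) ^ 2 := by
          gcongr
          have : (0 : ℝ) ≤ n := by positivity
          linarith
        _ = n * ε ^ 2 * (y * √(N : ℝ)) ^ 2 := by rw [hε]; field_simp
        _ ≤ _ := by gcongr
  have hbound := measureReal_le_card_mul (μ := μ) hsub
    (δ := (4 * Real.exp 1 * (ballConst γ (symMass B) + 1) * K * a / y) ^ n)
    fun p hp => by
      obtain ⟨g1, g2, g3⟩ := (Finset.mem_filter.1 hp).2
      have hz0 : z p ≠ 0 := by
        rw [← norm_pos_iff]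
        exact (mul_pos hy hsN).trans_le g1
      refine (hY.measure_norm_rowMap_le_of_not_nearLattice hB hz0 hγ (by positivity) hε0
        (D := y * √(N : ℝ)) ?_ g3).trans ?_
      · have : ε * (y * √(N : ℝ)) = 4 * K * a * √(N : ℝ) := by rw [hε]; field_simp
        rw [this]; exact hN1
      · have e : 4 * Real.exp 1 * (ballConst γ (symMass B) + 1) * K * a / y =
          Real.exp 1 * (ballConst γ (symMass B) * ε + ε) := by rw [hε]; field_simp
        rw [e]
        gcongr
  have hcard : (F.card : ℝ) ≤ (Real.exp 1 * (1 / c + 6) * y) ^ N := by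
    refine le_trans (Nat.cast_le.2 (Finset.card_filter_le _ _)) ?_
    refine (card_latticeBall_le (N := N) (3 * y) (l := 1 / (3 * y)) (by positivity)).trans ?_
    have e1 : 1 / (3 * y) * (3 * y) = 1 := by field_simp
    have e2 : 2 / (1 / (3 * y)) = 6 * y := by field_simp; norm_num
    rw [e1, e2, mul_assoc]
    gcongr
    have : 1 ≤ 1 / c * y := by rw [one_div_mul_eq_div, one_le_div hc]; exact hcy
    linarith
  exact hbound.trans (by gcongr)

/-- The kernel of a random matrix contains no vector near the integer lattice, up to norms that
are exponentially large in the aspect ratio. -/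
theorem exists_measure_kernel_nearLattice_le (hB : 0 < B) :
    ∃ γ a c₁ c₂ c c' : ℝ, 0 < γ ∧ 0 < a ∧ 0 < c₁ ∧ 0 < c₂ ∧ 0 < c ∧ 0 < c' ∧ c' < 1 ∧
      ∀ (N m n : ℕ), 0 < m → (m : ℝ) < c' * N → n + m = N →
      ∀ {Ω : Type*} [MeasurableSpace Ω] (μ : Measure Ω) [IsProbabilityMeasure μ]
        (Y : Fin n → Ω → EuclideanSpace ℝ (Fin N)),
        IsIIDSubgaussian B (fun (p : Fin n × Fin N) (ω : Ω) => Y p.1 ω p.2) μ →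
        μ.real {ω | ∃ x, rowMap (fun j => Y j ω) x = 0 ∧
          ‖x‖ < c₁ * √(N : ℝ) * Real.exp (c₂ * N / m) ∧ NearLattice γ (a * √(N : ℝ)) x} ≤
          Real.exp (-(c * N)) := by
  have hb := formMoment_pos hB
  set K := 12 * formMoment B with hKdef
  have hK : 0 < K := by positivity
  set γ := min (1 / 2) (1 / (6 * K)) with hγdef
  have hγ : 0 < γ := by positivity
  have hKγ : 32 * K ^ 2 * γ ^ 2 ≤ 1 := by
    have h1 : γ ≤ 1 / (6 * K) := min_le_right _ _
    have h2 : K * γ ≤ 1 / 6 := by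
      calc K * γ ≤ K * (1 / (6 * K)) := by gcongr
        _ = 1 / 6 := by field_simp
    have h3 : (K * γ) ^ 2 ≤ (1 / 6) ^ 2 := by gcongr
    rw [mul_pow] at h3
    linarith
  set η := 1 / (96 * formMoment B ^ 4) with hη
  have hη0 : 0 < η := by positivity
  set c₁ := min (η ^ 2 / 256) 1 with hc1
  have hc10 : 0 < c₁ := by positivity
  have hc11 : c₁ ≤ 1 := min_le_right _ _
  set q := symMass B with hq
  have hq0 : 0 < q := symMass_pos hB
  set C₃ := Real.exp 1 * (1 / c₁ + 6) with hC3
  have hC30 : 0 < C₃ := by positivity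
  set C₄ := 4 * Real.exp 1 * (ballConst γ q + 1) * K + 1 with hC4
  have hbc : 0 ≤ ballConst γ q := Real.sqrt_nonneg _
  have hC41 : 1 ≤ C₄ := by
    have : 0 ≤ 4 * Real.exp 1 * (ballConst γ q + 1) * K := by positivity
    linarith
  set r := Real.exp (-5) / (C₃ * C₄) with hr
  have hr0 : 0 < r := by positivity
  have hC3c : 1 / c₁ ≤ C₃ := by
    calc 1 / c₁ ≤ 1 * (1 / c₁ + 6) := by linarith
      _ ≤ C₃ := by
        rw [hC3]
        gcongr
        exact Real.one_le_exp (by norm_num)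
  have hrc : r ≤ c₁ := by
    rw [hr, div_le_iff₀ (by positivity)]
    have h1 : Real.exp (-5) ≤ 1 := Real.exp_le_one_iff.2 (by norm_num)
    have h2 : 1 ≤ c₁ * C₃ := by
      calc 1 = c₁ * (1 / c₁) := by field_simp
        _ ≤ _ := by gcongr
    calc Real.exp (-5) ≤ c₁ * C₃ * 1 := by linarith
      _ ≤ c₁ * C₃ * C₄ := by gcongr
      _ = _ := by ring
  -- Squared because only `n ≥ N/2` rows are available: `a^n = r^{2n} ≤ r^N`, which cancels `(C₃
  -- C₄)^N` and leaves `e^{-5N}`.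
  set a := r ^ 2 with ha
  have ha0 : 0 < a := by positivity
  have hac : a ≤ c₁ :=
    (pow_le_of_le_one hr0.le (hrc.trans hc11) two_ne_zero).trans hrc
  -- The second member keeps the lattice error `e^{-qa²N}` below `4Ka/y` for all `y ≤ e^{c₂N/m}`;
  -- the first bounds `y^m` by `e^N`.
  set c₂ := min 1 (q * a ^ 2 / 2) with hc2
  have hc20 : 0 < c₂ := by positivity
  set c₀ := min 1 (η / 4) with hc0
  have hc00 : 0 < c₀ := by positivity
  -- Since `m ≥ 1`, the hypothesis `m < N / N₀²` already forces `N > N₀²`; all requirements that `N`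
  -- be large enter through `N₀`.
  set N₀ := max (max (1 / (4 * K * a)) (1 / (2 * q * a ^ 3 * K))) (max 2 (4 / c₀)) with hN0
  have hN00 : 2 ≤ N₀ := (le_max_left _ _).trans (le_max_right _ _)
  have hγ2 : γ ≤ 1 / 2 := min_le_left _ _
  have hc1η : c₁ ≤ η ^ 2 / 256 := min_le_left _ _
  have hc21 : c₂ ≤ 1 := min_le_left _ _
  have hc2q : c₂ ≤ q * a ^ 2 / 2 := min_le_right _ _
  have hc01 : c₀ ≤ 1 := min_le_left _ _
  have hc0η : c₀ ≤ η / 4 := min_le_right _ _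
  have hN0a : 1 / (4 * K * a) ≤ N₀ := (le_max_left _ _).trans (le_max_left _ _)
  have hN0q : 1 / (2 * q * a ^ 3 * K) ≤ N₀ := (le_max_right _ _).trans (le_max_left _ _)
  have hN0c : 4 / c₀ ≤ N₀ := (le_max_right _ _).trans (le_max_right _ _)
  have hC4' : 4 * Real.exp 1 * (ballConst γ q + 1) * K ≤ C₄ := by linarith
  clear_value N₀ c₀ c₂ a r C₄ C₃ c₁ η γ
  refine ⟨γ, a, c₁, c₂, c₀ / 2, 1 / N₀ ^ 2, hγ, ha0, hc10, hc20, by positivity, by positivity,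
    ?_, ?_⟩
  · rw [div_lt_one (by positivity)]
    exact one_lt_pow₀ (by linarith) two_ne_zero
  intro N m n hm hmN hnm Ω _ μ _ Y hY
  have hmr : (1 : ℝ) ≤ m := by exact_mod_cast hm
  have hnmr : (n : ℝ) + m = N := by exact_mod_cast hnm
  have hN0N : N₀ ^ 2 < N := by
    have h1 : (1 : ℝ) < 1 / N₀ ^ 2 * N := lt_of_le_of_lt hmr hmN
    rwa [one_div_mul_eq_div, one_lt_div (by positivity)] at h1
  have hN0lt : N₀ ≤ N := (le_self_pow₀ (by linarith) two_ne_zero).trans hN0N.le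
  have hNr : (0 : ℝ) < N := by linarith
  have hNpos : 0 < N := by exact_mod_cast hNr
  have hnN2 : (N : ℝ) ≤ 2 * n := by
    have h1 : 1 / N₀ ^ 2 ≤ 1 / 4 := by
      apply one_div_le_one_div_of_le (by norm_num)
      calc (4 : ℝ) = 2 ^ 2 := by norm_num
        _ ≤ N₀ ^ 2 := by gcongr
    have : 1 / N₀ ^ 2 * N ≤ 1 / 4 * N := by gcongr
    linarith
  have hsN : N₀ ≤ √(N : ℝ) := Real.le_sqrt_of_sq_le hN0N.le
  have hsNpos : 0 < √(N : ℝ) := by linarith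
  have hsq : √(N : ℝ) ^ 2 = N := Real.sq_sqrt hNr.le
  have hN1 : 1 ≤ 4 * K * a * √(N : ℝ) := by
    have h1 : 1 / (4 * K * a) ≤ √(N : ℝ) := hN0a.trans hsN
    rw [div_le_iff₀ (by positivity)] at h1
    linarith
  have hratio : c₂ * N / m ≤ c₂ * N := div_le_self (by positivity) hmr
  set Λ := Real.exp (c₂ * N / m) with hΛ
  have hΛm : Λ ^ m = Real.exp (c₂ * N) := by
    rw [hΛ, ← Real.exp_nat_mul]; congr 1; field_simp
  have hN2 : ∀ y, 0 < y → y ≤ Λ →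
      Real.exp (-(q * (a * √(N : ℝ)) ^ 2)) ≤ 4 * K * a / y := by
    intro y hy hyΛ
    rw [le_div_iff₀ hy, mul_pow, hsq]
    have h1 : Real.exp (-(q * (a ^ 2 * N))) * y ≤ Real.exp (-(q * a ^ 2 / 2 * N)) := by
      calc _ ≤ Real.exp (-(q * (a ^ 2 * N))) * Real.exp (q * a ^ 2 / 2 * N) := by
            gcongr
            refine hyΛ.trans (Real.exp_le_exp.2 (hratio.trans ?_))
            gcongr
        _ = _ := by rw [← Real.exp_add]; congr 1; ring
    refine h1.trans ?_
    have h2 : 1 / (2 * q * a ^ 3 * K) ≤ N := hN0q.trans hN0lt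
    rw [div_le_iff₀ (by positivity)] at h2
    have h3 := Real.add_one_le_exp (q * a ^ 2 / 2 * N)
    rw [Real.exp_neg, inv_le_iff_one_le_mul₀ (Real.exp_pos _)]
    calc 1 ≤ N * (2 * q * a ^ 3 * K) := h2
      _ = 4 * K * a * (q * a ^ 2 / 2 * N) := by ring
      _ ≤ _ := by gcongr; linarith
  set bad : Ω → EuclideanSpace ℝ (Fin N) → Prop := fun ω x =>
    rowMap (fun j => Y j ω) x = 0 ∧ NearLattice γ (a * √(N : ℝ)) x with hbad
  set S₁ : Set Ω := {ω | ‖rowMap (fun j => Y j ω)‖ ≤ K * √(N : ℝ) ∧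
      ∃ x, rowMap (fun j => Y j ω) x = 0 ∧
      ‖x‖ < η ^ 2 / 256 * √(N : ℝ) ∧ ∃ p, ‖x - latticeVec p‖ < γ * ‖x‖} with hS1
  set S₂ : ℕ → Set Ω := fun k => {ω | c₁ * 2 ^ k ≤ Λ ∧ ‖rowMap (fun j => Y j ω)‖ ≤ K * √(N : ℝ) ∧
      ∃ x, rowMap (fun j => Y j ω) x = 0 ∧
      (c₁ * 2 ^ k * √(N : ℝ) ≤ ‖x‖ ∧ ‖x‖ < 2 * (c₁ * 2 ^ k * √(N : ℝ)) ∧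
        ∀ t : ℝ, |t| * ‖x‖ < c₁ * 2 ^ k * √(N : ℝ) → ¬ NearLattice γ (a * √(N : ℝ)) (t • x)) ∧
      ∃ p, ‖x - latticeVec p‖ < a * √(N : ℝ)} with hS2
  set S₃ : Set Ω := {ω | K * √(N : ℝ) < ‖rowMap (fun j => Y j ω)‖} with hS3
  have hcover : {ω | ∃ x, rowMap (fun j => Y j ω) x = 0 ∧
          ‖x‖ < c₁ * √(N : ℝ) * Λ ∧ NearLattice γ (a * √(N : ℝ)) x} ⊆
      (S₃ ∪ S₁) ∪ ⋃ k ∈ Finset.range (2 * N + 1), S₂ k := by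
    rintro ω ⟨x₀, hx0, hxn, hxl⟩
    by_cases hω3 : ω ∈ S₃
    · exact Or.inl (Or.inl hω3)
    have hL : ‖rowMap (fun j => Y j ω)‖ ≤ K * √(N : ℝ) := not_lt.1 hω3
    by_cases hω1 : ω ∈ S₁
    · exact Or.inl (Or.inr hω1)
    right
    -- The lowest dyadic level is taken. The kernel is closed under scaling, so a shorter multiple
    -- near the lattice would contradict minimality; this yields the condition on multiples in `S₂`.
    have hex : ∃ k : ℕ, ∃ x, bad ω x ∧ ‖x‖ < c₁ * 2 ^ k * √(N : ℝ) := by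
      obtain ⟨k, hk⟩ := pow_unbounded_of_one_lt Λ (one_lt_two (α := ℝ))
      refine ⟨k, x₀, ⟨hx0, hxl⟩, hxn.trans ?_⟩
      rw [mul_right_comm]
      gcongr
    classical
    obtain ⟨x, hx, hxlt⟩ := Nat.find_spec hex
    have hmin := fun k (h : k < Nat.find hex) => Nat.find_min hex h
    set j := Nat.find hex with hj
    have hj0 : j ≠ 0 := by
      intro h0
      apply hω1
      rw [h0, pow_zero, mul_one] at hxlt
      obtain ⟨p, hp⟩ := hx.2
      refine ⟨hL, x, hx.1, hxlt.trans_le ?_, p, hp.trans_le (min_le_left _ _)⟩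
      gcongr
    obtain ⟨k, hk⟩ := Nat.exists_eq_succ_of_ne_zero hj0
    have hmink := hmin k (by omega)
    have hkΛ : (2 : ℝ) ^ k < Λ := by
      by_contra h
      refine hmink ⟨x₀, ⟨hx0, hxl⟩, hxn.trans_le ?_⟩
      rw [mul_right_comm]
      gcongr
      exact not_lt.1 h
    have hkN : k < 2 * N + 1 := by
      have h1 : Λ ≤ 2 ^ (2 * N) := by
        calc Λ ≤ Real.exp (1 * N) := by
              refine Real.exp_le_exp.2 (hratio.trans ?_)
              gcongr
          _ = Real.exp 1 ^ N := by rw [← Real.exp_nat_mul]; congr 1; ring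
          _ ≤ 4 ^ N := by
              gcongr
              have := Real.exp_one_lt_d9
              linarith
          _ = 2 ^ (2 * N) := by rw [pow_mul]; norm_num
      have h2 : (2 : ℝ) ^ k < 2 ^ (2 * N) := hkΛ.trans_le h1
      have := (pow_lt_pow_iff_right₀ (one_lt_two (α := ℝ))).1 h2
      omega
    simp only [Set.mem_iUnion, Finset.mem_range]
    obtain ⟨p, hp⟩ := hx.2
    refine ⟨k, hkN, ?_, hL, x, hx.1, ⟨?_, ?_, ?_⟩, p, hp.trans_le (min_le_right _ _)⟩
    · exact (mul_le_of_le_one_left (by positivity) hc11).trans hkΛ.le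
    · by_contra h
      exact hmink ⟨x, hx, not_le.1 h⟩
    · rw [hk, pow_succ] at hxlt
      linarith
    · intro t ht hnear
      refine hmink ⟨t • x, ⟨by rw [map_smul, hx.1, smul_zero], hnear⟩, ?_⟩
      rw [norm_smul]
      exact ht
  have hP3 : μ.real S₃ ≤ Real.exp (-(c₀ * N)) := by
    refine (hY.measure_opNorm_le hB (by omega) hNpos).trans (Real.exp_le_exp.2 ?_)
    exact neg_le_neg (mul_le_of_le_one_left hNr.le hc01)
  have hP1 : μ.real S₁ ≤ Real.exp (-(c₀ * N)) := by
    refine (hY.measure_kernel_small_le hB hnN2 hK.le hγ.le hγ2 hKγ hη).trans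
      (Real.exp_le_exp.2 ?_)
    exact neg_le_neg (by gcongr)
  -- The central cancellation: `N` powers of `y` from counting against `n` from the small ball
  -- estimate leave only `m = N - n`.
  have hpow : ∀ y : ℝ, 0 < y →
      (C₃ * y) ^ N * (C₄ * a / y) ^ n = C₃ ^ N * C₄ ^ n * a ^ n * y ^ m := by
    intro y hy
    rw [mul_pow, div_pow, mul_pow, ← hnm, pow_add y]
    field_simp
  have hP2k : ∀ k, μ.real (S₂ k) ≤ Real.exp (-(4 * N)) := by
    intro k
    by_cases hkΛ : c₁ * 2 ^ k ≤ Λ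
    swap
    · have : S₂ k = ∅ := Set.eq_empty_of_forall_notMem fun ω hω => hkΛ hω.1
      rw [this]
      simp [Real.exp_nonneg]
    set y := c₁ * 2 ^ k with hy
    have hyc : c₁ ≤ y := le_mul_of_one_le_right hc10.le (one_le_pow₀ one_le_two)
    have hy0 : 0 < y := hc10.trans_le hyc
    have h1 := hY.measure_kernel_level_le hB hnN2 hK hγ ha0 hc10 hyc (hac.trans hyc) hN1
      (hN2 y hy0 hkΛ)
    refine (measureReal_mono (fun ω hω => hω.2)).trans (h1.trans ?_)
    have e1 : 4 * Real.exp 1 * (ballConst γ (symMass B) + 1) * K * a / y ≤ C₄ * a / y := by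
      gcongr
    calc _ ≤ (C₃ * y) ^ N * (C₄ * a / y) ^ n := by rw [hC3]; gcongr
      _ = C₃ ^ N * C₄ ^ n * a ^ n * y ^ m := hpow y hy0
      _ ≤ C₃ ^ N * C₄ ^ N * r ^ N * Real.exp N := by
        gcongr
        · omega
        · rw [ha, ← pow_mul]
          refine pow_le_pow_of_le_one hr0.le (hrc.trans hc11) ?_
          exact_mod_cast hnN2
        · calc y ^ m ≤ Λ ^ m := by gcongr
            _ = Real.exp (c₂ * N) := hΛm
            _ ≤ _ := by
              exact Real.exp_le_exp.2 (mul_le_of_le_one_left hNr.le hc21)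
      _ = Real.exp (-5) ^ N * Real.exp N := by
        rw [← mul_pow, ← mul_pow, hr]
        congr 2
        field_simp
      _ = _ := by
        rw [← Real.exp_nat_mul, ← Real.exp_add]; congr 1; ring
  have hP2 : μ.real (⋃ k ∈ Finset.range (2 * N + 1), S₂ k) ≤ Real.exp (-(c₀ * N)) := by
    refine (measureReal_le_card_mul subset_rfl fun k _ => hP2k k).trans ?_
    rw [Finset.card_range]
    have h1 : ((2 * N + 1 : ℕ) : ℝ) ≤ Real.exp (2 * N) := by
      push_cast
      exact Real.add_one_le_exp _
    calc _ ≤ Real.exp (2 * N) * Real.exp (-(4 * N)) := by gcongr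
      _ = Real.exp (-(2 * N)) := by rw [← Real.exp_add]; congr 1; ring
      _ ≤ _ := by
        refine Real.exp_le_exp.2 (neg_le_neg ?_)
        gcongr
        linarith
  have htot : 3 * Real.exp (-(c₀ * N)) ≤ Real.exp (-(c₀ / 2 * N)) := by
    have h1 : 4 / c₀ ≤ N := hN0c.trans hN0lt
    rw [div_le_iff₀ hc00] at h1
    have h2 : (3 : ℝ) ≤ Real.exp (c₀ / 2 * N) := by
      have := Real.add_one_le_exp (c₀ / 2 * N)
      linarith
    calc _ ≤ Real.exp (c₀ / 2 * N) * Real.exp (-(c₀ * N)) := by gcongr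
      _ = _ := by rw [← Real.exp_add]; congr 1; ring
  refine (measureReal_mono hcover).trans ?_
  refine (measureReal_union_le _ _).trans ?_
  have := measureReal_union_le (μ := μ) S₃ S₁
  linarith

end Kernel

/-! ### Transfer to the law of the matrix. -/

/-- With it the kernel estimate applies to the law of `Y`, so that the exceptional event becomes a
set of matrices. -/
theorem IsIIDSubgaussian.of_comp {Ω Ω' ι : Type*} [Fintype ι] [MeasurableSpace Ω]
    [MeasurableSpace Ω'] {μ : Measure Ω} [IsProbabilityMeasure μ] {B : ℝ} {φ : Ω → Ω'}
    (hφ : Measurable φ) {ξ : ι → Ω' → ℝ} (hξ : ∀ i, Measurable (ξ i))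
    (h : IsIIDSubgaussian B (fun i ω => ξ i (φ ω)) μ) : IsIIDSubgaussian B ξ (μ.map φ) := by
  have := Measure.isProbabilityMeasure_map (μ := μ) hφ.aemeasurable
  have hmap : ∀ i, (μ.map φ).map (ξ i) = μ.map (fun ω => ξ i (φ ω)) := fun i =>
    Measure.map_map (hξ i) hφ
  refine ⟨hξ, ?_, fun i j => ⟨(hξ i).aemeasurable, (hξ j).aemeasurable, ?_⟩, fun i => ?_,
    fun i => ?_, fun i => ⟨(h.subgaussian i).1, fun t ht => ?_⟩⟩
  · rw [iIndepFun_iff_map_fun_eq_infinitePi_map hξ, Measure.map_map (by fun_prop) hφ]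
    simp_rw [hmap]
    exact (iIndepFun_iff_map_fun_eq_infinitePi_map h.measurable).1 h.indep
  · rw [hmap, hmap]
    exact (h.identDistrib i j).map_eq
  · rw [integral_map hφ.aemeasurable (hξ i).aestronglyMeasurable]
    exact h.mean_zero i
  · rw [variance_map (hξ i).aemeasurable hφ.aemeasurable]
    exact h.unit_variance i
  · rw [map_measureReal_apply hφ (measurableSet_lt measurable_const (by fun_prop))]
    exact (h.subgaussian i).2 t ht

/-! ### From distances to projections. -/

section Geometry

variable {n m N : ℕ}

/-- Rank-nullity gives kernel dimension at least `m`. If the rows are dependent it is larger, and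
`m` orthonormal vectors still suffice for a lower bound on the distance. -/
theorem exists_isometry_ker_rowMap (hnm : n + m = N) (y : Fin n → EuclideanSpace ℝ (Fin N)) :
    ∃ A : EuclideanSpace ℝ (Fin m) →ₗᵢ[ℝ] EuclideanSpace ℝ (Fin N),
      ∀ g, rowMap y (A g) = 0 := by
  set k := LinearMap.ker (rowMap y).toLinearMap with hk
  have hfr : m ≤ Module.finrank ℝ k := by
    have h1 := LinearMap.finrank_range_add_finrank_ker (rowMap y).toLinearMap
    have h2 := Submodule.finrank_le (LinearMap.range (rowMap y).toLinearMap)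
    rw [finrank_euclideanSpace, Fintype.card_fin] at h1 h2
    rw [← hk] at h1
    omega
  set v : Fin m → EuclideanSpace ℝ (Fin N) :=
    fun i => (stdOrthonormalBasis ℝ k (Fin.castLE hfr i) : EuclideanSpace ℝ (Fin N)) with hv
  have hvo : Orthonormal ℝ v :=
    ((stdOrthonormalBasis ℝ k).orthonormal.comp_linearIsometry k.subtypeₗᵢ).comp _
      (Fin.castLE_injective hfr)
  set b := (EuclideanSpace.basisFun (Fin m) ℝ).toBasis with hb
  have hbo : Orthonormal ℝ b := by
    rw [hb, OrthonormalBasis.coe_toBasis]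
    exact (EuclideanSpace.basisFun (Fin m) ℝ).orthonormal
  set f := b.constr ℝ v with hf
  have hfv : f ∘ b = v := by
    ext1 i
    simp [hf]
  refine ⟨f.isometryOfOrthonormal hbo (by rwa [hfv]), fun g => ?_⟩
  have h1 : f g ∈ LinearMap.range f := LinearMap.mem_range_self f g
  rw [hf, b.constr_range] at h1
  have h2 : Submodule.span ℝ (Set.range v) ≤ k :=
    Submodule.span_le.2 (by rintro _ ⟨i, rfl⟩; exact Subtype.prop _)
  exact LinearMap.mem_ker.1 (h2 h1)

theorem norm_adjoint_sub_lt_of_infDist_lt {y : Fin n → EuclideanSpace ℝ (Fin N)}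
    {A : EuclideanSpace ℝ (Fin m) →ₗᵢ[ℝ] EuclideanSpace ℝ (Fin N)}
    (hA : ∀ g, rowMap y (A g) = 0) {x v : EuclideanSpace ℝ (Fin N)} {r : ℝ}
    (h : Metric.infDist x (subspaceTranslate (spanOf y) v) < r) :
    ‖A.toContinuousLinearMap.adjoint x - A.toContinuousLinearMap.adjoint v‖ < r := by
  have hne : (subspaceTranslate (spanOf y) v).Nonempty := ⟨0 + v, 0, Submodule.zero_mem _, rfl⟩
  obtain ⟨_, ⟨u, hu, rfl⟩, hlt⟩ := (Metric.infDist_lt_iff hne).1 h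
  set T := A.toContinuousLinearMap.adjoint with hT
  have hTu : T u = 0 := by
    have hle : spanOf y ≤ LinearMap.ker T.toLinearMap := by
      refine Submodule.span_le.2 ?_
      rintro _ ⟨j, rfl⟩
      refine LinearMap.mem_ker.2 (ext_inner_left ℝ fun g => ?_)
      change inner ℝ g (T (y j)) = _
      rw [hT, ContinuousLinearMap.adjoint_inner_right, inner_zero_right, real_inner_comm]
      change inner ℝ (y j) (A g) = 0
      rw [← rowMap_apply, hA g]
      rfl
    exact LinearMap.mem_ker.1 (hle hu)
  have hTn : ‖T‖ ≤ 1 := by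
    rw [hT, LinearIsometryEquiv.norm_map]
    exact A.norm_toContinuousLinearMap_le
  have e : T x - T v = T (x - (u + v)) := by rw [map_sub, map_add, hTu, zero_add]
  rw [e]
  calc ‖T (x - (u + v))‖ ≤ ‖T‖ * ‖x - (u + v)‖ := T.le_opNorm _
    _ ≤ 1 * ‖x - (u + v)‖ := by gcongr
    _ < r := by rwa [one_mul, ← dist_eq_norm]

/-- Needed for measurability in the Fubini argument. Fixing the coefficients of the linear
combination gives a union of open sets, regardless of where the rank jumps. -/
theorem isOpen_infDist_spanOf_lt (v : EuclideanSpace ℝ (Fin N)) (r : ℝ) :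
    IsOpen {p : EuclideanSpace ℝ (Fin N) × (Fin n → EuclideanSpace ℝ (Fin N)) |
      Metric.infDist p.1 (subspaceTranslate (spanOf p.2) v) < r} := by
  have e : {p : EuclideanSpace ℝ (Fin N) × (Fin n → EuclideanSpace ℝ (Fin N)) |
      Metric.infDist p.1 (subspaceTranslate (spanOf p.2) v) < r} =
      ⋃ a : Fin n → ℝ, {p | dist p.1 (∑ j, a j • p.2 j + v) < r} := by
    ext p
    have hne : (subspaceTranslate (spanOf p.2) v).Nonempty := ⟨0 + v, 0, Submodule.zero_mem _, rfl⟩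
    rw [Set.mem_iUnion]
    change Metric.infDist p.1 (subspaceTranslate (spanOf p.2) v) < r ↔
      ∃ a : Fin n → ℝ, dist p.1 (∑ j, a j • p.2 j + v) < r
    rw [Metric.infDist_lt_iff hne]
    constructor
    · rintro ⟨_, ⟨u, hu, rfl⟩, hlt⟩
      obtain ⟨a, rfl⟩ := (Submodule.mem_span_range_iff_exists_fun ℝ).1 hu
      exact ⟨a, hlt⟩
    · rintro ⟨a, ha⟩
      exact ⟨_, ⟨_, (Submodule.mem_span_range_iff_exists_fun ℝ).2 ⟨a, rfl⟩, rfl⟩, ha⟩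
  rw [e]
  exact isOpen_iUnion fun a => isOpen_lt (by fun_prop) continuous_const

end Geometry

/-! ### Fixed subspaces and conditioning on the matrix. -/

section Distance

variable {Ω : Type*} [MeasurableSpace Ω] {μ : Measure Ω} [IsProbabilityMeasure μ] {m n N : ℕ}
  {B : ℝ} {X : Ω → EuclideanSpace ℝ (Fin N)}

/-- Distance to a fixed subspace whose orthogonal complement is far from the integer lattice. -/
theorem IsIIDSubgaussian.measure_infDist_lt_le (hm : 0 < m) (hB : 0 < B)
    (hX : IsIIDSubgaussian B (fun (i : Fin N) (ω : Ω) => X ω i) μ) (hnm : n + m = N)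
    {y : Fin n → EuclideanSpace ℝ (Fin N)} {γ α D ε : ℝ} (hγ : 0 < γ) (hα : 0 ≤ α) (hε : 0 < ε)
    (hy : ∀ x, rowMap y x = 0 → ‖x‖ < D → ¬ NearLattice γ α x) (hD : √(m : ℝ) ≤ ε * D)
    (v : EuclideanSpace ℝ (Fin N)) :
    μ.real {ω | Metric.infDist (X ω) (subspaceTranslate (spanOf y) v) < ε * √(m : ℝ)} ≤
      Real.exp m * ((ballConst γ (symMass B) * ε) ^ m + Real.exp (-(symMass B * α ^ 2))) := by
  obtain ⟨A, hA⟩ := exists_isometry_ker_rowMap hnm y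
  set T := A.toContinuousLinearMap.adjoint with hT
  have h := hX.small_ball hm hB A hγ hα hε (D := D)
    (fun g hg => hy _ (hA g) (by rwa [A.norm_map])) hD (T v)
  set f : Ω → ℝ := fun ω => Real.exp (-‖T (X ω) - T v‖ ^ 2 / (2 * ε ^ 2)) with hf
  have hfm : Measurable f := by
    have : Measurable fun ω => T (X ω) - T v :=
      (T.continuous.measurable.comp hX.measurable_vec).sub_const _
    fun_prop
  have hfi : Integrable f μ := by
    refine (integrable_const (1 : ℝ)).mono' hfm.aestronglyMeasurable
      (Filter.Eventually.of_forall fun ω => ?_)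
    rw [Real.norm_of_nonneg (Real.exp_pos _).le]
    refine Real.exp_le_one_iff.2 ?_
    rw [neg_div]
    exact neg_nonpos.2 (by positivity)
  have hmk := mul_meas_ge_le_integral_of_nonneg
    (Filter.Eventually.of_forall fun ω => (Real.exp_pos _).le : 0 ≤ᵐ[μ] f) hfi
    (Real.exp (-(m / 2 : ℝ)))
  -- When the distance is below `ε√m`, the Gaussian weight is at least `e^{-m/2}`; Markov thus
  -- contributes the second factor `e^{m/2}`.
  have hsub : {ω | Metric.infDist (X ω) (subspaceTranslate (spanOf y) v) < ε * √(m : ℝ)} ⊆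
      {ω | Real.exp (-(m / 2 : ℝ)) ≤ f ω} := by
    intro ω hω
    have h1 := norm_adjoint_sub_lt_of_infDist_lt hA hω
    refine Real.exp_le_exp.2 ?_
    rw [neg_div, neg_le_neg_iff, div_le_iff₀ (by positivity)]
    have h2 : ‖T (X ω) - T v‖ ^ 2 ≤ (ε * √(m : ℝ)) ^ 2 := by gcongr
    rw [mul_pow, Real.sq_sqrt (by positivity)] at h2
    linarith
  calc _ ≤ μ.real {ω | Real.exp (-(m / 2 : ℝ)) ≤ f ω} := measureReal_mono hsub
    _ = Real.exp (m / 2) * (Real.exp (-(m / 2 : ℝ)) *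
        μ.real {ω | Real.exp (-(m / 2 : ℝ)) ≤ f ω}) := by
      rw [← mul_assoc, ← Real.exp_add]; simp
    _ ≤ Real.exp (m / 2) * (Real.exp (m / 2) *
        ((ballConst γ (symMass B) * ε) ^ m + Real.exp (-(symMass B * α ^ 2)))) :=
      mul_le_mul_of_nonneg_left (hmk.trans h) (Real.exp_pos _).le
    _ = _ := by
      rw [← mul_assoc, ← Real.exp_add]
      congr 2
      ring

/-- If `X` is independent of `Y`, an event about `(X, Y)` whose sections over all good values of
`Y` have probability at most `δ` has probability at most `δ` plus that of the bad values. -/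
theorem measureReal_indep_le {E F : Type*} [MeasurableSpace E] [MeasurableSpace F] {X : Ω → E}
    {Y : Ω → F} (hX : Measurable X) (hY : Measurable Y) (hXY : IndepFun X Y μ) {S : Set (E × F)}
    (hS : MeasurableSet S) {bad : Set F} {δ : ℝ} (hδ : 0 ≤ δ)
    (h : ∀ y, y ∉ bad → μ.real {ω | (X ω, y) ∈ S} ≤ δ) :
    μ.real {ω | (X ω, Y ω) ∈ S} ≤ δ + (μ.map Y).real bad := by
  have := Measure.isProbabilityMeasure_map (μ := μ) hX.aemeasurable
  have := Measure.isProbabilityMeasure_map (μ := μ) hY.aemeasurable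
  set ν := μ.map Y
  have h1 : μ {ω | (X ω, Y ω) ∈ S} = ∫⁻ y, μ.map X ((fun x => (x, y)) ⁻¹' S) ∂ν := by
    rw [← Measure.prod_apply_symm hS, ← (indepFun_iff_map_prod_eq_prod_map_map hX.aemeasurable
      hY.aemeasurable).1 hXY, Measure.map_apply (hX.prodMk hY) hS]
    rfl
  have h2 : μ {ω | (X ω, Y ω) ∈ S} ≤ ENNReal.ofReal δ + ν bad := by
    rw [h1]
    -- The bad set is not known to be measurable, so a measurable hull of the same measure replaces
    -- it.
    calc ∫⁻ y, μ.map X ((fun x => (x, y)) ⁻¹' S) ∂ν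
        ≤ ∫⁻ y, (ENNReal.ofReal δ + (toMeasurable ν bad).indicator 1 y) ∂ν := by
          refine lintegral_mono fun y => ?_
          by_cases hy : y ∈ toMeasurable ν bad
          · rw [Set.indicator_of_mem hy]
            exact prob_le_one.trans le_add_self
          · have hyb : y ∉ bad := fun hb => hy (subset_toMeasurable ν bad hb)
            rw [Set.indicator_of_notMem hy, add_zero,
              Measure.map_apply hX (measurable_prodMk_right hS)]
            change μ {ω | (X ω, y) ∈ S} ≤ _
            rw [← ofReal_measureReal]
            exact ENNReal.ofReal_le_ofReal (h y hyb)
      _ = ENNReal.ofReal δ + ν bad := by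
          rw [lintegral_add_left measurable_const,
            lintegral_indicator_one (measurableSet_toMeasurable _ _), measure_toMeasurable]
          simp
  rw [measureReal_def]
  refine (ENNReal.toReal_mono (by finiteness) h2).trans_eq ?_
  rw [ENNReal.toReal_add ENNReal.ofReal_ne_top (measure_ne_top _ _), ENNReal.toReal_ofReal hδ]
  rfl

end Distance

/-! ### Assembling the estimate. -/

theorem mainTheorem5 (B B' : ℝ) (hB : 0 < B) (hB' : 0 < B') :
    ∃ C c c' : ℝ, 0 < C ∧ 0 < c ∧ 0 < c' ∧ c' < 1 ∧
      ∀ (N m : ℕ), 0 < m → (m : ℝ) < c' * (N : ℝ) →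
      ∀ {Ω : Type*} [MeasurableSpace Ω] (μ : Measure Ω) [IsProbabilityMeasure μ]
        (X : Ω → EuclideanSpace ℝ (Fin N))
        (Y : Fin (N - m) → Ω → EuclideanSpace ℝ (Fin N)),
        IsIIDSubgaussian B (fun (i : Fin N) (ω : Ω) => X ω i) μ →
        IsIIDSubgaussian B' (fun (p : Fin (N - m) × Fin N) (ω : Ω) => Y p.1 ω p.2) μ →
        IndepFun X (fun (ω : Ω) (j : Fin (N - m)) => Y j ω) μ →
        ∀ (v : EuclideanSpace ℝ (Fin N)) (ε : ℝ), 0 < ε →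
          μ.real {ω | Metric.infDist (X ω) (subspaceTranslate (spanOf (fun j => Y j ω)) v)
              < ε * Real.sqrt (m : ℝ)}
            ≤ (C * ε) ^ m + Real.exp (-c * (N : ℝ)) := by
  obtain ⟨γ, a, c₁, c₂, c₃, c₄, hγ, ha, hc1, hc2, hc3, hc4, hc41, hker⟩ :=
    exists_measure_kernel_nearLattice_le hB'
  set q := symMass B
  have hq : 0 < q := symMass_pos hB
  set C₀ := ballConst γ q
  have hC0 : 0 ≤ C₀ := Real.sqrt_nonneg _
  set d := min c₂ (q * a ^ 2)
  have hd : 0 < d := by positivity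
  have hd2 : d ≤ c₂ := min_le_left _ _
  have hdq : d ≤ q * a ^ 2 := min_le_right _ _
  set M := 2 * Real.exp 1 * C₀ / c₁ + Real.exp 1
  have hMe : Real.exp 1 ≤ M := le_add_of_nonneg_left (by positivity)
  have hMC : 2 * Real.exp 1 * C₀ / c₁ ≤ M := le_add_of_nonneg_right (Real.exp_pos _).le
  have hM0 : 0 < M := (Real.exp_pos _).trans_le hMe
  have hlog : 1 ≤ Real.log M := (Real.le_log_iff_exp_le hM0).2 hMe
  set κ := min (d / 2) c₃
  have hκ : 0 < κ := by positivity
  have hκd : κ ≤ d / 2 := min_le_left _ _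
  have hκc : κ ≤ c₃ := min_le_right _ _
  -- The three bounds serve the kernel theorem, the absorption `M^m ≤ e^{dN/2}`, and `κN ≥ 4`, which
  -- follows from `m ≥ 1`.
  set c' := min c₄ (min (d / (2 * Real.log M)) (κ / 4))
  have hc'4 : c' ≤ c₄ := min_le_left _ _
  have hc'M : c' ≤ d / (2 * Real.log M) := (min_le_right _ _).trans (min_le_left _ _)
  have hc'κ : c' ≤ κ / 4 := (min_le_right _ _).trans (min_le_right _ _)
  have hc' : 0 < c' := by positivity
  clear_value c' κ M d
  refine ⟨2 * Real.exp 1 * C₀ + 1, κ / 2, c', by positivity, by positivity, hc',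
    hc'4.trans_lt hc41, ?_⟩
  intro N m hm hmN Ω _ μ _ X Y hX hY hXY v ε hε
  have hmr : (1 : ℝ) ≤ m := by exact_mod_cast hm
  have hNr : (0 : ℝ) < N := by
    by_contra h
    nlinarith
  have hmN4 : (m : ℝ) < c₄ * N := hmN.trans_le (by gcongr)
  have hmltN : m < N := by
    have : (m : ℝ) < N := hmN4.trans (mul_lt_of_lt_one_left hNr hc41)
    exact_mod_cast this
  have hnm : N - m + m = N := by omega
  have hXm := hX.measurable_vec
  have hYm : Measurable fun ω (j : Fin (N - m)) => Y j ω :=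
    measurable_pi_lambda _ fun j => (hY.row j).measurable_vec
  have := Measure.isProbabilityMeasure_map (μ := μ) hYm.aemeasurable
  have hY' : IsIIDSubgaussian B' (fun (p : Fin (N - m) × Fin N)
      (y : Fin (N - m) → EuclideanSpace ℝ (Fin N)) => y p.1 p.2)
      (μ.map fun ω (j : Fin (N - m)) => Y j ω) := by
    refine IsIIDSubgaussian.of_comp hYm (fun p => ?_) hY
    exact ((EuclideanSpace.proj p.2).continuous.comp (continuous_apply p.1)).measurable
  set Λ := Real.exp (c₂ * N / m) with hΛ
  have hΛm : Λ ^ m = Real.exp (c₂ * N) := by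
    rw [hΛ, ← Real.exp_nat_mul]; congr 1; field_simp
  set D := c₁ * √(N : ℝ) * Λ with hD
  have hsN : 0 < √(N : ℝ) := Real.sqrt_pos.2 hNr
  have hD0 : 0 < D := by positivity
  have hbad := hker N m (N - m) hm hmN4 hnm (μ.map fun ω (j : Fin (N - m)) => Y j ω)
    (fun j y => y j) hY'
  set bad : Set (Fin (N - m) → EuclideanSpace ℝ (Fin N)) := {y | ∃ x, rowMap (fun j => y j) x = 0 ∧
    ‖x‖ < D ∧ NearLattice γ (a * √(N : ℝ)) x} with hbaddef
  -- The small ball estimate is valid only at scales at least `√m/D`. Enlarging `ε` by this amount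
  -- covers every `ε > 0`; the excess costs at most `(M/Λ)^m ≤ e^{-dN/2}`.
  set ε₁ := ε + √(m : ℝ) / D with hε1
  have hε10 : 0 < ε₁ := by positivity
  have hε1D : √(m : ℝ) ≤ ε₁ * D := by
    rw [hε1, add_mul, div_mul_cancel₀ _ hD0.ne']
    exact le_add_of_nonneg_left (by positivity)
  set δ := Real.exp m * ((C₀ * ε₁) ^ m + Real.exp (-(q * (a * √(N : ℝ)) ^ 2))) with hδ
  have hmain := measureReal_indep_le hXm hYm hXY
    (isOpen_infDist_spanOf_lt (n := N - m) v (ε₁ * √(m : ℝ))).measurableSet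
    (bad := bad) (δ := δ) (by positivity) fun y hy =>
      hX.measure_infDist_lt_le hm hB hnm hγ (by positivity) hε10
        (fun x hx hxD hnear => hy ⟨x, hx, hxD, hnear⟩) hε1D v
  have hMm : M ^ m ≤ Real.exp (d / 2 * N) := by
    rw [← Real.exp_log hM0, ← Real.exp_nat_mul]
    apply Real.exp_le_exp.2
    rw [le_div_iff₀ (by positivity)] at hc'M
    calc (m : ℝ) * Real.log M ≤ c' * N * Real.log M := by gcongr
      _ = c' * (2 * Real.log M) * (N / 2) := by ring
      _ ≤ d * (N / 2) := by gcongr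
      _ = _ := by ring
  have hκN : 4 ≤ κ * N := by
    have : 1 ≤ κ / 4 * N := hmr.trans (hmN.le.trans (by gcongr))
    linarith
  have hexpm : Real.exp m = Real.exp 1 ^ m := by rw [← Real.exp_nat_mul, mul_one]
  have h1 : Real.exp m * (C₀ * ε₁) ^ m ≤
      ((2 * Real.exp 1 * C₀ + 1) * ε) ^ m + Real.exp (-(κ * N)) := by
    have h2 : (C₀ * ε₁) ^ m ≤ 2 ^ m * ((C₀ * ε) ^ m + (C₀ * (√(m : ℝ) / D)) ^ m) := by
      rw [hε1, mul_add]
      refine (add_pow_le (by positivity) (by positivity) m).trans ?_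
      gcongr
      · norm_num
      · omega
    have h3 : 2 * Real.exp 1 * C₀ * (√(m : ℝ) / D) ≤ M / Λ := by
      have h4 : √(m : ℝ) / √(N : ℝ) ≤ 1 :=
        div_le_one_of_le₀ (Real.sqrt_le_sqrt (by exact_mod_cast hmltN.le)) hsN.le
      calc 2 * Real.exp 1 * C₀ * (√(m : ℝ) / D)
          = 2 * Real.exp 1 * C₀ / c₁ * (√(m : ℝ) / √(N : ℝ)) / Λ := by
            rw [hD]; field_simp
        _ ≤ M * 1 / Λ := by gcongr
        _ = M / Λ := by rw [mul_one]
    calc Real.exp m * (C₀ * ε₁) ^ m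
        ≤ Real.exp m * (2 ^ m * ((C₀ * ε) ^ m + (C₀ * (√(m : ℝ) / D)) ^ m)) := by gcongr
      _ = (2 * Real.exp 1 * C₀ * ε) ^ m + (2 * Real.exp 1 * C₀ * (√(m : ℝ) / D)) ^ m := by
        rw [hexpm]; simp only [mul_pow]; ring
      _ ≤ ((2 * Real.exp 1 * C₀ + 1) * ε) ^ m + (M / Λ) ^ m := by
        gcongr
        linarith
      _ ≤ _ := by
        gcongr
        rw [div_pow, hΛm, div_eq_mul_inv, ← Real.exp_neg]
        calc M ^ m * Real.exp (-(c₂ * N)) ≤ Real.exp (d / 2 * N) * Real.exp (-(d * N)) := by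
              gcongr
          _ = Real.exp (-(d / 2 * N)) := by rw [← Real.exp_add]; congr 1; ring
          _ ≤ _ := by gcongr
  have h5 : Real.exp m * Real.exp (-(q * (a * √(N : ℝ)) ^ 2)) ≤ Real.exp (-(κ * N)) := by
    rw [mul_pow, Real.sq_sqrt hNr.le, ← mul_assoc]
    calc _ ≤ M ^ m * Real.exp (-(d * N)) := by
          rw [hexpm]
          gcongr
      _ ≤ Real.exp (d / 2 * N) * Real.exp (-(d * N)) := by gcongr
      _ = Real.exp (-(d / 2 * N)) := by rw [← Real.exp_add]; congr 1; ring
      _ ≤ _ := by gcongr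
  have h6 : (μ.map fun ω (j : Fin (N - m)) => Y j ω).real bad ≤ Real.exp (-(κ * N)) :=
    hbad.trans (by gcongr)
  -- Three errors are merged here: the enlargement of `ε`, the lattice term, and the exceptional
  -- matrices.
  have h7 : 3 * Real.exp (-(κ * N)) ≤ Real.exp (-(κ / 2) * N) := by
    have h8 : (3 : ℝ) ≤ Real.exp (κ / 2 * N) := by
      have := Real.add_one_le_exp (κ / 2 * N)
      linarith
    calc _ ≤ Real.exp (κ / 2 * N) * Real.exp (-(κ * N)) := by gcongr
      _ = _ := by rw [← Real.exp_add]; congr 1; ring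
  have h9 : ε * √(m : ℝ) ≤ ε₁ * √(m : ℝ) := by
    gcongr
    exact le_add_of_nonneg_right (by positivity)
  have h10 : μ.real {ω | Metric.infDist (X ω) (subspaceTranslate (spanOf (fun j => Y j ω)) v)
      < ε * √(m : ℝ)} ≤ δ + (μ.map fun ω (j : Fin (N - m)) => Y j ω).real bad := by
    refine le_trans (measureReal_mono fun ω hω => ?_) hmain
    exact lt_of_lt_of_le hω h9
  rw [hδ, mul_add] at h10
  linarith
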